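/- Let $T$ be a finite rooted (multicast) tree with root $v_0$. Every node $v_j\neq v_0$ is joined to its parent by a link, called link $j$. A probe sent from $v_0$ is passed by link $j$ with probability $\alpha_j\in(0,1]$, independently over all links and all probes $t=1,2,\dots$. Write $\bar\alpha_j=1-\alpha_j$ and $\|\bar\alpha\|=\max_j\bar\alpha_j$. The receivers are the leaves; a node $v_j$ *observes* a probe if the probe reaches at least one leaf at or below $v_j$. Fix a node $v_k$, let $d_k$ be the set of its children and let $\Sigma_k$ be the set of nonempty subsets of $d_k$. Let $A_k$ be the product of the $\alpha_j$, and $s_k$ the sum of the $\bar\alpha_j$, over all links on the path from $v_0$ to $v_k$ (the link into $v_k$ included). For $x\subseteq d_k$ put $t_x=\sum_{j\in x}\bar\alpha_j$ (so $t_\emptyset=0$). For $x\in\Sigma_k$ let $\gamma_x$ be the probability that a probe is observed by all members of $x$, let $\hat\gamma_x$ be the fraction of the first $n$ probes observed by all members of $x$ (with $\hat\gamma_j=\hat\gamma_{\{j\}}$), and let $\hat\gamma_k$ be the fraction of the first $n$ probes observed by $v_k$. For $2\le i\le|d_k|$ let $$\hat A_k(i)=\Bigg(\frac{\sum_{x\in\Sigma_k,\,|x|=i}\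 \prod_{j\in x}\hat\gamma_j}{\sum_{x\in\Sigma_k,\,|x|=i}\ \hat\gamma_x}\Bigg)^{1/(i-1)}$$ be the $i$-wise composite likelihood estimator of $A_k$. Let $\hat A_k$, the full likelihood estimator, be the solution $A>0$, $A\ge\hat\gamma_k$, of $1-\hat\gamma_k/A=\prod_{j\in d_k}(1-\hat\gamma_j/A)$. (On data where a denominator vanishes, or where this equation does not have exactly one such solution, the estimator is given the value $0$.) Below, $O(\|\bar\alpha\|^2)$ refers to $\|\bar\alpha\|\to0$; the constants depend only on $T$, $k$ and $i$. 1. (Covariances.) For all $n\ge1$ and $x,y\in\Sigma_k$, $n\,\mathrm{Cov}(\hat\gamma_x,\hat\gamma_y)=\gamma_{x\cup y}-\gamma_x\gamma_y$; if $y\subseteq x$, this equals $\gamma_x(1-\gamma_y)$. 2. (First order.) If no child of $v_k$ has exactly one child, then for all $n\ge1$ and $x,y\in\Sigma_k$, $n\,\mathrm{Cov}(\hat\gamma_x,\hat\gamma_y)=s_k+t_{x\cap y}+O(\|\bar\alpha\|^2)$, uniformly in $n$; in particular it is $s_k+t_y+O(\|\bar\alpha\|^2)$ if $y\subseteq x$.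 3. (Asymptotic variance.) Let $|d_k|\ge2$ and $2\le i\le|d_k|$. As $n\to\infty$, $\sqrt n\,(\hat A_k(i)-A_k)$ converges in distribution to a Gaussian with mean $0$ and a variance $v$ depending only on $T,k,i,\alpha$, and $\sqrt n\,(\hat A_k-A_k)$ converges in distribution to a Gaussian with mean $0$ and a variance $w$ depending only on $T,k,\alpha$. Moreover $v=s_k+O(\|\bar\alpha\|^2)$ and $w=s_k+O(\|\bar\alpha\|^2)$; in particular the two variances agree to first order, $v-w=O(\|\bar\alpha\|^2)$. (A Gaussian of variance $0$ is the point mass at $0$.) -/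

import Mathlib

open MeasureTheory ProbabilityTheory Filter
open scoped NNReal Topology

/-- A finite rooted tree on the node set `V`, given by the parent map; the root is its own parent
by convention, and iterating the parent map from any node leads to the root. -/
structure MulticastTree (V : Type*) where
  root : V
  parent : V → V
  parent_root : parent root = root
  reaches_root : ∀ v, ∃ n : ℕ, parent^[n] v = root

namespace MulticastTree

variable {V : Type*} (T : MulticastTree V)

/-- The links of the tree: every node `v` other than the root is joined to its parent by one link,
which is named after its lower end `v`. -/
abbrev Link : Type _ := {v : V // v ≠ T.root}

/-- `T.Below v u`: the node `v` is `u` or a descendant of `u`. -/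
def Below (v u : V) : Prop := ∃ n : ℕ, T.parent^[n] v = u

variable [Fintype V] [DecidableEq V]

open Classical in
/-- The links on the path from the root to `v`. -/
noncomputable def path (v : V) : Finset T.Link := Finset.univ.filter fun e => T.Below v e.1

open Classical in
/-- The set `d_v` of descendants attached to `v`: the links that start at `v`, each of them standing
for the multicast subtree of which it is the root link. -/
noncomputable def children (v : V) : Finset T.Link := Finset.univ.filter fun e => T.parent e.1 = v

open Classical in
/-- The receivers `R(v)`: the leaves of the tree that lie at or below `v`. -/
noncomputable def receivers (v : V) : Finset V :=
  Finset.univ.filter fun r => T.children r = ∅ ∧ T.Below r v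

/-- `Σ_v`: the nonempty sets of descendants attached to `v`. -/
noncomputable def observerSets (v : V) : Finset (Finset T.Link) :=
  (T.children v).powerset.filter fun x => x.Nonempty

/-! ### The outcome of one probe

`b e = true` says that the probe is passed by the link `e`, if it gets there. -/

/-- The probe reaches the node `v`. -/
def Reaches (b : T.Link → Bool) (v : V) : Prop := ∀ e ∈ T.path v, b e = true

/-- The probe is observed by at least one receiver at or below `v`. -/
def Observed (b : T.Link → Bool) (v : V) : Prop := ∃ r ∈ T.receivers v, T.Reaches b r

/-- The probe is observed by every member of `x`. -/
def CoObserved (b : T.Link → Bool) (x : Finset T.Link) : Prop := ∀ e ∈ x, T.Observed b e.1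

/-! ### Statistics and estimators

`b t e = true` says that link `e` passes the probe number `t`; the first `n` probes are used. -/

open Classical in
/-- The number `n_v(1)` of confirmed arrivals at `v`. -/
noncomputable def confirmedArrivals (n : ℕ) (b : ℕ → T.Link → Bool) (v : V) : ℝ :=
  ∑ t ∈ Finset.range n, if T.Observed (b t) v then 1 else 0

open Classical in
/-- The number `I(x)` of probes observed by all members of `x`. -/
noncomputable def coObservations (n : ℕ) (b : ℕ → T.Link → Bool) (x : Finset T.Link) : ℝ :=
  ∑ t ∈ Finset.range n, if T.CoObserved (b t) x then 1 else 0

/-- The empirical pass rate `I(x) / n`. -/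
noncomputable def empiricalRate (n : ℕ) (b : ℕ → T.Link → Bool) (x : Finset T.Link) : ℝ :=
  T.coObservations n b x / n

/-- The `i`-wise explicit composite likelihood estimate of the pass rate of the path to `k`. -/
noncomputable def compositeEstimator (k : V) (i n : ℕ) (b : ℕ → T.Link → Bool) : ℝ :=
  ((∑ x ∈ (T.children k).powersetCard i, ∏ e ∈ x, T.empiricalRate n b {e}) /
    (∑ x ∈ (T.children k).powersetCard i, T.empiricalRate n b x)) ^ (1 / ((i : ℝ) - 1))

/-- `A` solves the full likelihood equation for the path to `k`, in the range `A ≥ n_k(1) / n`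
(the path to `k` passes at least the probes confirmed at `k`). -/
def IsFullLikelihoodRoot (k : V) (n : ℕ) (b : ℕ → T.Link → Bool) (A : ℝ) : Prop :=
  0 < A ∧ T.confirmedArrivals n b k / n ≤ A ∧
    1 - T.confirmedArrivals n b k / n / A =
      ∏ e ∈ T.children k, (1 - T.empiricalRate n b {e} / A)

open Classical in
/-- The full likelihood estimate: the unique solution of the full likelihood equation in its range
(and `0` for data where there is not exactly one). -/
noncomputable def fullLikelihoodEstimator (k : V) (n : ℕ) (b : ℕ → T.Link → Bool) : ℝ :=
  if h : ∃! A, T.IsFullLikelihoodRoot k n b A then h.choose else 0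

/-! ### Parameters -/

/-- The pass rate `A_k` of the path from the root to `k`. -/
noncomputable def pathRate (α : T.Link → ℝ) (k : V) : ℝ := ∏ e ∈ T.path k, α e

/-- The loss rates of the links; its (supremum) norm is the largest loss rate. -/
def lossRate (α : T.Link → ℝ) : T.Link → ℝ := fun e => 1 - α e

/-- `s_k`: the sum of the loss rates of the links on the path from the root to `k`. -/
noncomputable def pathLoss (α : T.Link → ℝ) (k : V) : ℝ := ∑ e ∈ T.path k, T.lossRate α e

/-- `t_x`: the sum of the loss rates of the links in `x`. -/
noncomputable def setLoss (α : T.Link → ℝ) (x : Finset T.Link) : ℝ := ∑ e ∈ x, T.lossRate α e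

/-- The Bernoulli loss model: `B t e` tells whether link `e` passes probe `t`; all these outcomes
are independent, and link `e` passes each probe with probability `α e`. -/
structure IsLossModel (α : T.Link → ℝ) {Ω : Type*} [MeasurableSpace Ω] (P : Measure Ω)
    (B : ℕ → T.Link → Ω → Bool) : Prop where
  measurable : ∀ t e, Measurable (B t e)
  indep : iIndepFun (fun p : ℕ × T.Link => B p.1 p.2) P
  pass_rate : ∀ t e, P.real {ω | B t e ω = true} = α e

/-- The pass rate `γ_x`: the probability that a probe is observed by all members of `x`. -/
noncomputable def passRate {Ω : Type*} [MeasurableSpace Ω] (P : Measure Ω)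
    (B : ℕ → T.Link → Ω → Bool) (x : Finset T.Link) : ℝ :=
  P.real {ω | T.CoObserved (fun e => B 0 e ω) x}

end MulticastTree

/-! Every statistic here is a function of the empirical law of the outcomes of `n` probes, which
form an i.i.d. sample from the product law `prob α` on `T.Link → Bool` (`IsLossModel.isSample`). The
exact covariances follow at once: for two empirical means, `n` times the covariance is the
covariance for a single probe, and the indicators of `x` and `y` multiply to that of `x ∪ y`.

The first-order statements rest on `isBigO_cov_sub`. Near `α = 1` only outcomes with at most one
loss matter, so `cov α f g` is the sum over `e` of `(1 - α e) * Δ_e f * Δ_e g`, up to `O(‖α - 1‖ ^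
2)`, where `Δ_e` is the change when `e` alone fails. Here `f` and `g` may depend differentiably on
`α`, and `Δ_e` is taken at `α = 1`. First-order covariances thus become combinatorics of single
losses: if no child of `k` has exactly one child, losing `e` hides a probe from `x` exactly when `e`
lies on the path to `k` or in `x` (`coInd_loss`).

For the estimators, the delta method (`tendstoInDistribution_of_isLittleO`) gives a Gaussian limit
with variance `cov α H H`, where `H` is the influence function. The composite estimator is explicit
and is differentiated directly. The full one solves an equation: its root is shown to be unique and
continuous in the data, and is then expanded implicitly (`isLittleO_solution`). At `α = 1` either
influence function drops by `1` under a loss on the path to `k` and ignores every other single loss,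
because a loss off the path is felt by at most one of the two or more children of `k`
(`fullInfluence_loss`, `compositeInfluence_loss`). So both variances are the path loss up to second
order; this needs no condition on the grandchildren. -/

set_option linter.unusedSectionVars false

/-! ### Independent Bernoulli trials with rare failures -/

namespace ProductBernoulli

lemma _root_.DifferentiableAt.fun_finsetProd_of_real {E κ : Type*} [NormedAddCommGroup E]
    [NormedSpace ℝ E] {f : κ → E → ℝ} {s : Finset κ} {x : E}
    (hf : ∀ i ∈ s, DifferentiableAt ℝ (f i) x) :
    DifferentiableAt ℝ (fun y => ∏ i ∈ s, f i y) x := by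
  classical
  exact (HasFDerivAt.finsetProd fun i hi => (hf i hi).hasFDerivAt).differentiableAt

variable {ι : Type*}

/-- The outcome at which only the trial `e` fails. -/
def loss [DecidableEq ι] (e : ι) : ι → Bool := fun e' => decide (e' ≠ e)

variable [Fintype ι]

/-- The probability of the outcome `c` of independent Bernoulli trials with success rates `α`. -/
def prob (α : ι → ℝ) (c : ι → Bool) : ℝ := ∏ e, if c e then α e else 1 - α e

/-- The mean of `f` under the product Bernoulli law with success rates `α`. -/
def mean [DecidableEq ι] (α : ι → ℝ) (f : (ι → Bool) → ℝ) : ℝ := ∑ c, prob α c * f c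

/-- The covariance of `f` and `g` under the product Bernoulli law with success rates `α`. -/
def cov [DecidableEq ι] (α : ι → ℝ) (f g : (ι → Bool) → ℝ) : ℝ :=
  mean α (fun c => f c * g c) - mean α f * mean α g

lemma prob_nonneg {α : ι → ℝ} (hα : ∀ e, α e ∈ Set.Ioc (0 : ℝ) 1) (c : ι → Bool) :
    0 ≤ prob α c := by
  refine Finset.prod_nonneg fun e _ => ?_
  have := hα e
  split_ifs
  · exact this.1.le
  · linarith [this.2]

lemma prob_top (α : ι → ℝ) : prob α (fun _ => true) = ∏ e, α e := by simp [prob]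

lemma prob_one_top : prob (1 : ι → ℝ) (fun _ => true) = 1 := by simp [prob]

lemma prob_one_of_ne {c : ι → Bool} (hc : c ≠ fun _ => true) : prob (1 : ι → ℝ) c = 0 := by
  obtain ⟨e, he⟩ := Function.ne_iff.1 hc
  exact Finset.prod_eq_zero (Finset.mem_univ e) (by simp_all)

lemma differentiable_prob (c : ι → Bool) : Differentiable ℝ fun α : ι → ℝ => prob α c := by
  unfold prob
  refine fun α => DifferentiableAt.fun_finsetProd_of_real fun e _ => ?_
  split_ifs <;> fun_prop

open Asymptotics

lemma isBigO_sub_one {F : (ι → ℝ) → ℝ} (hF : DifferentiableAt ℝ F 1) :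
    (fun α => F α - F 1) =O[𝓝 1] fun α => ‖α - 1‖ := hF.isBigO_sub.norm_right

lemma isBigO_one_sub (e : ι) :
    (fun α : ι → ℝ => 1 - α e) =O[𝓝 1] fun α => ‖α - 1‖ := by
  refine IsBigO.of_bound 1 (Eventually.of_forall fun α => ?_)
  rw [one_mul, norm_norm, norm_sub_rev]
  exact norm_le_pi_norm (α - 1) e

variable [DecidableEq ι]

lemma mean_prod (α : ι → ℝ) (f : ι → Bool → ℝ) :
    mean α (fun c => ∏ e, f e (c e)) = ∏ e, (α e * f e true + (1 - α e) * f e false) := by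
  have := (Finset.prod_univ_sum (fun _ : ι => (Finset.univ : Finset Bool))
    (fun e b => (if b then α e else 1 - α e) * f e b)).symm
  rw [Fintype.piFinset_univ] at this
  simpa only [mean, prob, ← Finset.prod_mul_distrib, Fintype.sum_bool, if_true, Bool.false_eq_true,
    if_false] using this

lemma sum_prob (α : ι → ℝ) : ∑ c, prob α c = 1 := by
  simpa [mean] using mean_prod α fun _ _ => 1

lemma mean_one (f : (ι → Bool) → ℝ) : mean 1 f = f fun _ => true := by
  unfold mean
  rw [Finset.sum_eq_single fun _ => true]
  · rw [prob_one_top, one_mul]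
  · intro c _ hc
    rw [prob_one_of_ne hc, zero_mul]
  · simp

lemma mean_const (α : ι → ℝ) (a : ℝ) : mean α (fun _ => a) = a := by
  simp [mean, ← Finset.sum_mul, sum_prob]

lemma mean_sub (α : ι → ℝ) (f g : (ι → Bool) → ℝ) :
    mean α (fun c => f c - g c) = mean α f - mean α g := by
  simp [mean, mul_sub]

lemma mean_mul_const (α : ι → ℝ) (f : (ι → Bool) → ℝ) (a : ℝ) :
    mean α (fun c => f c * a) = mean α f * a := by
  simp [mean, Finset.sum_mul, mul_assoc]

lemma mean_pos {α : ι → ℝ} (hα : ∀ e, α e ∈ Set.Ioc (0 : ℝ) 1) {f : (ι → Bool) → ℝ}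
    (hf : ∀ c, 0 ≤ f c) (hf' : 0 < f fun _ => true) : 0 < mean α f := by
  refine Finset.sum_pos' (fun c _ => mul_nonneg (prob_nonneg hα c) (hf c))
    ⟨fun _ => true, Finset.mem_univ _, mul_pos ?_ hf'⟩
  rw [prob_top]
  exact Finset.prod_pos fun e _ => (hα e).1

lemma mean_mono {α : ι → ℝ} (hα : ∀ e, α e ∈ Set.Ioc (0 : ℝ) 1) {f g : (ι → Bool) → ℝ}
    (hfg : ∀ c, f c ≤ g c) : mean α f ≤ mean α g :=
  Finset.sum_le_sum fun c _ => mul_le_mul_of_nonneg_left (hfg c) (prob_nonneg hα c)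

lemma differentiable_mean (f : (ι → Bool) → ℝ) : Differentiable ℝ fun α : ι → ℝ => mean α f := by
  unfold mean
  exact Differentiable.fun_sum fun c _ => (differentiable_prob c).mul_const _

/-- Independence of disjoint groups of trials: an outcome splits into its parts on `S` and off `S`,
`prob` factors accordingly, and each factor sums to `1`. -/
lemma mean_mul_of_dependsOn (α : ι → ℝ) {f g : (ι → Bool) → ℝ} {S : Set ι}
    (hf : DependsOn f S) (hg : DependsOn g Sᶜ) :
    mean α (fun c => f c * g c) = mean α f * mean α g := by
  classical
  let E := Equiv.piEquivPiSubtypeProd (fun e => e ∈ S) (fun _ : ι => Bool)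
  have hp : ∀ y, prob α (E.symm y) =
      prob (fun e : {e // e ∈ S} => α e) y.1 * prob (fun e : {e // ¬ e ∈ S} => α e) y.2 := by
    intro y
    unfold prob
    rw [← Fintype.prod_subtype_mul_prod_subtype (fun e => e ∈ S)]
    congr 1 <;> refine Finset.prod_congr rfl fun e _ => ?_ <;> simp [E, Equiv.piEquivPiSubtypeProd, e.2]
  have hf' : ∀ y z, f (E.symm (y, z)) = f (E.symm (y, fun _ => true)) := fun y z =>
    hf fun e he => by simp [E, Equiv.piEquivPiSubtypeProd, he]
  have hg' : ∀ y z, g (E.symm (y, z)) = g (E.symm (fun _ => true, z)) := fun y z =>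
    hg fun e he => by
      have he' : ¬ e ∈ S := he
      simp [E, Equiv.piEquivPiSubtypeProd, he']
  have key : ∀ h : (ι → Bool) → ℝ, mean α h = ∑ y, ∑ z,
      prob (fun e : {e // e ∈ S} => α e) y * prob (fun e : {e // ¬ e ∈ S} => α e) z *
        h (E.symm (y, z)) := by
    intro h
    unfold mean
    rw [← E.symm.sum_comp, Fintype.sum_prod_type]
    simp_rw [hp]
  have hF : mean α f = ∑ y, prob (fun e : {e // e ∈ S} => α e) y *
      f (E.symm (y, fun _ => true)) := by
    rw [key]
    refine Finset.sum_congr rfl fun y _ => ?_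
    simp_rw [hf' y]
    rw [← Finset.sum_mul, ← Finset.mul_sum, sum_prob, mul_one]
  have hG : mean α g = ∑ z, prob (fun e : {e // ¬ e ∈ S} => α e) z *
      g (E.symm (fun _ => true, z)) := by
    rw [key, Finset.sum_comm]
    refine Finset.sum_congr rfl fun z _ => ?_
    simp_rw [hg' _ z]
    rw [← Finset.sum_mul, ← Finset.sum_mul, sum_prob, one_mul]
  rw [key, hF, hG, Finset.sum_mul_sum]
  refine Finset.sum_congr rfl fun y _ => Finset.sum_congr rfl fun z _ => ?_
  rw [hf' y z, hg' y z]
  ring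

lemma mean_mul_prod_of_dependsOn {κ : Type*} (α : ι → ℝ) {f : (ι → Bool) → ℝ}
    {g : κ → (ι → Bool) → ℝ} {S : Set ι} {D : κ → Set ι} (s : Finset κ)
    (hf : DependsOn f S) (hg : ∀ j ∈ s, DependsOn (g j) (D j)) (hS : ∀ j ∈ s, Disjoint S (D j))
    (hD : ∀ i ∈ s, ∀ j ∈ s, i ≠ j → Disjoint (D i) (D j)) :
    mean α (fun c => f c * ∏ j ∈ s, g j c) = mean α f * ∏ j ∈ s, mean α (g j) := by
  classical
  induction s using Finset.induction_on with
  | empty => simp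
  | insert a s ha ih =>
    have h := mean_mul_of_dependsOn α (f := g a) (g := fun c => f c * ∏ j ∈ s, g j c)
      (hg a (Finset.mem_insert_self a s)) (fun c c' hcc => ?_)
    · simp_rw [Finset.prod_insert ha]
      calc _ = mean α (fun c => g a c * (f c * ∏ j ∈ s, g j c)) := by
            congr 1; ext c; ring
        _ = _ := by
          rw [h, ih (fun j hj => hg j (Finset.mem_insert_of_mem hj))
            (fun j hj => hS j (Finset.mem_insert_of_mem hj))
            (fun i hi j hj => hD i (Finset.mem_insert_of_mem hi) j (Finset.mem_insert_of_mem hj))]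
          ring
    · have h1 : f c = f c' := hf fun e he => hcc e fun h =>
        Set.disjoint_left.1 (hS a (Finset.mem_insert_self a s)) he h
      have h2 : ∏ j ∈ s, g j c = ∏ j ∈ s, g j c' := Finset.prod_congr rfl fun j hj =>
        hg j (Finset.mem_insert_of_mem hj) fun e he => hcc e fun h =>
          Set.disjoint_left.1 (hD j (Finset.mem_insert_of_mem hj) a (Finset.mem_insert_self a s)
            (ne_of_mem_of_not_mem hj ha)) he h
      simp only [h1, h2]

/-- Covariance is unchanged by subtracting constants. The useful choice is the value at the lossless
outcome, the only one of probability not `O(‖α - 1‖)`. -/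
lemma cov_eq (α : ι → ℝ) (f g : (ι → Bool) → ℝ) (a b : ℝ) :
    cov α f g = mean α (fun c => (f c - a) * (g c - b)) -
      mean α (fun c => f c - a) * mean α (fun c => g c - b) := by
  have h : (fun c => (f c - a) * (g c - b)) =
      fun c => (f c * g c - f c * b) - (g c * a - a * b) := by ext c; ring
  rw [cov, h, mean_sub, mean_sub, mean_sub, mean_sub, mean_sub, mean_const, mean_const, mean_const,
    mean_mul_const, mean_mul_const]
  ring

lemma cov_self_nonneg {α : ι → ℝ} (hα : ∀ e, α e ∈ Set.Ioc (0 : ℝ) 1) (f : (ι → Bool) → ℝ) :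
    0 ≤ cov α f f := by
  rw [cov_eq α f f (mean α f) (mean α f), mean_sub, mean_const, sub_self, zero_mul, sub_zero]
  exact Finset.sum_nonneg fun c _ => mul_nonneg (prob_nonneg hα c) (mul_self_nonneg _)

lemma isBigO_prob {c : ι → Bool} (hc : c ≠ fun _ => true) :
    (fun α : ι → ℝ => prob α c) =O[𝓝 1] fun α => ‖α - 1‖ := by
  simpa [prob_one_of_ne hc] using isBigO_sub_one (differentiable_prob c).differentiableAt

/-- To first order in the loss rates, at most one of the trials fails. -/
lemma isBigO_prob_sub {c : ι → Bool} (hc : c ≠ fun _ => true) :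
    (fun α : ι → ℝ => prob α c - ∑ e, if c = loss e then 1 - α e else 0) =O[𝓝 1]
      fun α => ‖α - 1‖ ^ 2 := by
  obtain ⟨a, ha⟩ := Function.ne_iff.1 hc
  replace ha : c a = false := by simpa using ha
  have h1 : ∀ α : ι → ℝ, (∑ e, if c = loss e then 1 - α e else 0) =
      (1 - α a) * if c = loss a then 1 else 0 := by
    intro α
    rw [Finset.sum_eq_single a]
    · split_ifs <;> simp
    · intro e _ hea
      rw [if_neg]
      rintro rfl
      simp [loss, hea.symm] at ha
    · simp
  -- One factor `1 - α a` of `prob α c` is already first order. The remaining product `F` may be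
  -- replaced by its value at `α = 1`, which is `1` if `a` is the only failure and `0` otherwise.
  let F : (ι → ℝ) → ℝ := fun α => ∏ e ∈ Finset.univ.erase a, if c e then α e else 1 - α e
  have h2 : ∀ α : ι → ℝ, prob α c = (1 - α a) * F α := by
    intro α
    rw [prob, ← Finset.mul_prod_erase _ _ (Finset.mem_univ a)]
    simp [ha, F]
  have hF : Differentiable ℝ F := by
    refine fun α => DifferentiableAt.fun_finsetProd_of_real fun e _ => ?_
    split_ifs <;> fun_prop
  have hF1 : F 1 = if c = loss a then 1 else 0 := by
    split_ifs with h
    · refine Finset.prod_eq_one fun e he => ?_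
      simp [h, loss, Finset.ne_of_mem_erase he]
    · obtain ⟨e, he⟩ := Function.ne_iff.1 h
      have hea : e ≠ a := by
        rintro rfl
        simp [loss, ha] at he
      refine Finset.prod_eq_zero (Finset.mem_erase.2 ⟨hea, Finset.mem_univ e⟩) ?_
      simp [loss, hea] at he
      simp [he]
  have := (isBigO_one_sub a).mul (isBigO_sub_one (hF 1))
  refine this.congr (fun α => ?_) fun α => ?_
  · rw [h1, h2, hF1]; ring
  · ring

/-- The covariance to first order in the loss rates: only the single losses contribute. -/
theorem isBigO_cov_sub {f g : (ι → ℝ) → (ι → Bool) → ℝ}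
    (hf : ∀ c, DifferentiableAt ℝ (fun α => f α c) 1)
    (hg : ∀ c, DifferentiableAt ℝ (fun α => g α c) 1) :
    (fun α => cov α (f α) (g α) - ∑ e, (1 - α e) *
      ((f 1 (loss e) - f 1 fun _ => true) * (g 1 (loss e) - g 1 fun _ => true))) =O[𝓝 1]
      fun α => ‖α - 1‖ ^ 2 := by
  set df : (ι → ℝ) → (ι → Bool) → ℝ := fun α c => f α c - f α fun _ => true with hdf
  set dg : (ι → ℝ) → (ι → Bool) → ℝ := fun α c => g α c - g α fun _ => true with hdg
  have hdf' : ∀ c, DifferentiableAt ℝ (fun α => df α c) 1 := fun c => (hf c).sub (hf _)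
  have hdg' : ∀ c, DifferentiableAt ℝ (fun α => dg α c) 1 := fun c => (hg c).sub (hg _)
  have hmean : ∀ d : (ι → ℝ) → (ι → Bool) → ℝ, (∀ c, DifferentiableAt ℝ (fun α => d α c) 1) →
      (∀ α, (d α fun _ => true) = 0) →
      (fun α => mean α (d α)) =O[𝓝 1] fun α => ‖α - 1‖ := by
    intro d hd hd0
    refine IsBigO.fun_sum fun c _ => ?_
    by_cases hc : c = fun _ => true
    · simp [hc, hd0, isBigO_zero]
    · simpa using (isBigO_prob hc).mul ((hd c).continuousAt.tendsto.isBigO_one ℝ)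
  -- The centred functions vanish at the lossless outcome, so each mean is first order and their
  -- product is negligible.
  have hprod : (fun α => mean α (df α) * mean α (dg α)) =O[𝓝 1] fun α => ‖α - 1‖ ^ 2 :=
    ((hmean df hdf' (by simp [hdf])).mul (hmean dg hdg' (by simp [hdg]))).congr_right
      fun α => by ring
  have hmain : (fun α => mean α (fun c => df α c * dg α c) -
      ∑ e, (1 - α e) * (df 1 (loss e) * dg 1 (loss e))) =O[𝓝 1] fun α => ‖α - 1‖ ^ 2 := by
    have hre : ∀ α : ι → ℝ, ∑ e, (1 - α e) * (df 1 (loss e) * dg 1 (loss e)) =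
        ∑ c, (∑ e, if c = loss e then 1 - α e else 0) * (df 1 c * dg 1 c) := by
      intro α
      simp_rw [Finset.sum_mul]
      rw [Finset.sum_comm]
      refine Finset.sum_congr rfl fun e _ => ?_
      rw [Finset.sum_eq_single (loss e)]
      · simp
      · intro c _ hc
        simp [hc]
      · simp
    simp_rw [hre, mean, ← Finset.sum_sub_distrib]
    refine IsBigO.fun_sum fun c _ => ?_
    by_cases hc : c = fun _ => true
    · simp [hc, hdf, isBigO_zero]
    -- Two replacements, each costing second order: the functions by their values at `α = 1`, since
    -- `prob α c` is first order, and `prob α c` by its single-loss part.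
    · have hd : DifferentiableAt ℝ (fun α => df α c * dg α c) 1 := (hdf' c).mul (hdg' c)
      have h1 := ((isBigO_prob hc).mul (isBigO_sub_one hd)).congr_right
        (g₂ := fun α => ‖α - 1‖ ^ 2) fun α => by ring
      have h2 := (isBigO_prob_sub hc).mul
        (isBigO_refl (fun _ : ι → ℝ => df 1 c * dg 1 c) (𝓝 1) |>.trans
          (isBigO_const_const _ (one_ne_zero (α := ℝ)) _))
      simp only [mul_one] at h2
      refine (h1.add h2).congr_left fun α => ?_
      ring
  refine (hmain.sub hprod).congr_left fun α => ?_
  rw [cov_eq α (f α) (g α) (f α fun _ => true) (g α fun _ => true)]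
  simp only [hdf, hdg]
  ring

end ProductBernoulli

/-! ### Empirical laws of finite-valued samples and the delta method -/

namespace ProbabilityTheory

/-- Random variables indexed by pairs that are independent remain so when grouped by the first
index. -/
lemma iIndepFun.curry {ι κ 𝓧 Ω : Type*} [MeasurableSpace 𝓧] [MeasurableSpace Ω] {P : Measure Ω}
    {X : ι → κ → Ω → 𝓧} (mX : ∀ i j, Measurable (X i j))
    (h : iIndepFun (fun p : ι × κ => X p.1 p.2) P) :
    iIndepFun (fun i ω j => X i j ω) P := by
  have := h.isProbabilityMeasure
  have : ∀ i j, IsProbabilityMeasure (P.map (X i j)) :=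
    fun i j => Measure.isProbabilityMeasure_map (mX i j).aemeasurable
  rw [iIndepFun_iff_map_fun_eq_infinitePi_map (by fun_prop)]
  have h2 : ∀ i, P.map (fun ω j => X i j ω) = Measure.infinitePi fun j => P.map (X i j) := fun i =>
    (iIndepFun_iff_map_fun_eq_infinitePi_map (mX i)).1
      (h.precomp (g := fun j => (i, j)) (fun _ _ h => (Prod.mk.inj h).2))
  simp_rw [h2]
  rw [← Measure.infinitePi_map_curry, ← (iIndepFun_iff_map_fun_eq_infinitePi_map
    (X := fun p : ι × κ => X p.1 p.2) fun p => mX p.1 p.2).1 h,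
    Measure.map_map (by fun_prop) (by fun_prop)]
  rfl

variable {C : Type*} [Fintype C] [DecidableEq C]

/-- The law of the first `n` outcomes of the sequence `x`. -/
noncomputable def empiricalLaw (n : ℕ) (x : ℕ → C) (c : C) : ℝ :=
  (∑ t ∈ Finset.range n, if x t = c then 1 else 0) / n

lemma sum_empiricalLaw_mul (n : ℕ) (x : ℕ → C) (f : C → ℝ) :
    ∑ c, empiricalLaw n x c * f c = (∑ t ∈ Finset.range n, f (x t)) / n := by
  simp_rw [empiricalLaw, div_mul_eq_mul_div, ← Finset.sum_div, Finset.sum_mul]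
  rw [Finset.sum_comm]
  simp

lemma empiricalLaw_mem_stdSimplex {n : ℕ} (hn : n ≠ 0) (x : ℕ → C) :
    empiricalLaw n x ∈ stdSimplex ℝ C := by
  refine ⟨fun c => ?_, ?_⟩
  · unfold empiricalLaw
    positivity
  · have := sum_empiricalLaw_mul n x fun _ => 1
    simp only [mul_one, Finset.sum_const, Finset.card_range, nsmul_eq_mul] at this
    rw [this, div_self (by exact_mod_cast hn)]

lemma empiricalLaw_congr {n : ℕ} {x y : ℕ → C} (h : ∀ t < n, x t = y t) :
    empiricalLaw n x = empiricalLaw n y := by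
  ext c
  unfold empiricalLaw
  congr 1
  exact Finset.sum_congr rfl fun t ht => by rw [h t (Finset.mem_range.1 ht)]

variable [MeasurableSpace C] [MeasurableSingletonClass C]
  {Ω : Type*} [MeasurableSpace Ω] {P : Measure Ω}

/-- `X` is a sequence of independent outcomes with law `p`. -/
structure IsSample (X : ℕ → Ω → C) (p : C → ℝ) (P : Measure Ω) : Prop where
  measurable : ∀ t, Measurable (X t)
  indep : iIndepFun X P
  law : ∀ t c, P.real (X t ⁻¹' {c}) = p c

namespace IsSample

variable {X : ℕ → Ω → C} {p : C → ℝ}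

lemma isProbabilityMeasure (h : IsSample X p P) : IsProbabilityMeasure P :=
  h.indep.isProbabilityMeasure

lemma measurable_comp {β : Type*} [MeasurableSpace β] (h : IsSample X p P) (f : C → β) (t : ℕ) :
    Measurable fun ω => f (X t ω) :=
  (measurable_of_countable f).comp (h.measurable t)

lemma integral_eq (h : IsSample X p P) (f : C → ℝ) (t : ℕ) :
    ∫ ω, f (X t ω) ∂P = ∑ c, p c * f c := by
  have := h.isProbabilityMeasure
  have := Measure.isProbabilityMeasure_map (μ := P) (h.measurable t).aemeasurable
  rw [← integral_map (h.measurable t).aemeasurable (measurable_of_countable f).aestronglyMeasurable,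
    integral_fintype (.of_finite)]
  refine Finset.sum_congr rfl fun c _ => ?_
  rw [map_measureReal_apply (h.measurable t) (measurableSet_singleton c), h.law, smul_eq_mul]

lemma memLp (h : IsSample X p P) (f : C → ℝ) (t : ℕ) : MemLp (fun ω => f (X t ω)) 2 P := by
  have := h.isProbabilityMeasure
  refine MemLp.of_bound (h.measurable_comp f t).aestronglyMeasurable (∑ c, ‖f c‖) ?_
  exact Eventually.of_forall fun ω =>
    Finset.single_le_sum (f := fun c => ‖f c‖) (fun c _ => norm_nonneg _) (Finset.mem_univ (X t ω))

lemma identDistrib (h : IsSample X p P) (f : C → ℝ) (t : ℕ) :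
    IdentDistrib (fun ω => f (X t ω)) (fun ω => f (X 0 ω)) P P := by
  have := h.isProbabilityMeasure
  have : IdentDistrib (X t) (X 0) P P := by
    refine ⟨(h.measurable t).aemeasurable, (h.measurable 0).aemeasurable, ?_⟩
    refine Measure.ext_of_singleton fun c => ?_
    rw [Measure.map_apply (h.measurable t) (measurableSet_singleton c),
      Measure.map_apply (h.measurable 0) (measurableSet_singleton c),
      ← measureReal_eq_measureReal_iff, h.law, h.law]
  exact this.comp (measurable_of_countable f)

lemma covariance_eq (h : IsSample X p P) (f g : C → ℝ) (t : ℕ) :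
    covariance (fun ω => f (X t ω)) (fun ω => g (X t ω)) P =
      ∑ c, p c * (f c * g c) - (∑ c, p c * f c) * ∑ c, p c * g c := by
  have := h.isProbabilityMeasure
  rw [covariance_eq_sub (h.memLp f t) (h.memLp g t), h.integral_eq f, h.integral_eq g,
    ← h.integral_eq fun c => f c * g c]
  rfl

lemma covariance_of_ne (h : IsSample X p P) (f g : C → ℝ) {s t : ℕ} (hst : s ≠ t) :
    covariance (fun ω => f (X s ω)) (fun ω => g (X t ω)) P = 0 :=
  ((h.indep.indepFun hst).comp (measurable_of_countable f)
    (measurable_of_countable g)).covariance_eq_zero (h.memLp f s) (h.memLp g t)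

/-- The covariance of two empirical means. -/
lemma mul_covariance_average (h : IsSample X p P) (f g : C → ℝ) {n : ℕ} (hn : 1 ≤ n) :
    n * covariance (fun ω => (∑ t ∈ Finset.range n, f (X t ω)) / n)
        (fun ω => (∑ t ∈ Finset.range n, g (X t ω)) / n) P =
      ∑ c, p c * (f c * g c) - (∑ c, p c * f c) * ∑ c, p c * g c := by
  have := h.isProbabilityMeasure
  have hn' : (n : ℝ) ≠ 0 := by positivity
  simp_rw [div_eq_mul_inv]
  rw [covariance_mul_const_left, covariance_mul_const_right,
    covariance_fun_sum_fun_sum' (fun t _ => h.memLp f t) (fun t _ => h.memLp g t)]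
  have : ∀ s ∈ Finset.range n, ∑ t ∈ Finset.range n,
      covariance (fun ω => f (X s ω)) (fun ω => g (X t ω)) P =
      ∑ c, p c * (f c * g c) - (∑ c, p c * f c) * ∑ c, p c * g c := by
    intro s hs
    rw [Finset.sum_eq_single_of_mem s hs fun t _ hts => h.covariance_of_ne f g hts.symm,
      h.covariance_eq]
  rw [Finset.sum_congr rfl this, Finset.sum_const, Finset.card_range, nsmul_eq_mul]
  field_simp

/-- No regularity of `Φ` is needed, which matters for a root picked by choice: only the first `n`
outcomes enter, and they range over a finite type. -/
lemma measurable_empiricalLaw_comp {β : Type*} [MeasurableSpace β] (h : IsSample X p P) (n : ℕ)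
    (Φ : (C → ℝ) → β) : Measurable fun ω => Φ (empiricalLaw n fun t => X t ω) := by
  have := h.isProbabilityMeasure
  obtain ⟨ω₀⟩ := nonempty_of_isProbabilityMeasure P
  have hm : Measurable fun ω => fun t : Fin n => X t ω :=
    measurable_pi_lambda _ fun t => h.measurable t
  have h2 : (fun ω => Φ (empiricalLaw n fun t => X t ω)) =
      (fun y : Fin n → C => Φ (empiricalLaw n fun t => if ht : t < n then y ⟨t, ht⟩ else X 0 ω₀)) ∘
        fun ω => fun t : Fin n => X t ω := by
    ext ω
    simp only [Function.comp_apply]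
    congr 1
    exact empiricalLaw_congr fun t ht => by simp [ht]
  rw [h2]
  exact (measurable_of_countable _).comp hm

/-- The deviation of an empirical frequency is of order `1 / √n` in probability. -/
lemma measureReal_sqrt_mul_abs_le (h : IsSample X p P) (c : C) {n : ℕ} (hn : 1 ≤ n) {M : ℝ}
    (hM : 0 < M) :
    P.real {ω | M ≤ √n * |empiricalLaw n (fun t => X t ω) c - p c|} ≤ 1 / M ^ 2 := by
  have := h.isProbabilityMeasure
  have hn' : (0 : ℝ) < n := by exact_mod_cast hn
  set f : C → ℝ := fun d => if d = c then 1 else 0 with hf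
  have hsum : ∑ d, p d * f d = p c := by simp [hf]
  have hsum2 : ∑ d, p d * (f d * f d) = p c := by simp [hf]
  set Y : Ω → ℝ := fun ω => empiricalLaw n (fun t => X t ω) c with hY
  have hYf : Y = fun ω => (∑ t ∈ Finset.range n, f (X t ω)) / n := rfl
  have hmean : ∫ ω, Y ω ∂P = p c := by
    rw [hYf, integral_div, integral_finsetSum _ fun t _ => (h.memLp f t).integrable one_le_two]
    simp_rw [h.integral_eq f, hsum]
    simp [hn'.ne']
  have hmem : MemLp Y 2 P := by
    rw [hYf]
    simp_rw [div_eq_mul_inv]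
    exact (memLp_finsetSum _ fun t _ => h.memLp f t).mul_const _
  have hvar : n * variance Y P ≤ 1 := by
    rw [← covariance_self hmem.aemeasurable, hYf, h.mul_covariance_average f f hn, hsum, hsum2]
    nlinarith [sq_nonneg (p c - 1), sq_nonneg (p c)]
  have hset : {ω | M ≤ √n * |Y ω - p c|} = {ω | M / √n ≤ |Y ω - ∫ ω, Y ω ∂P|} := by
    ext ω
    simp only [Set.mem_ofPred_eq]
    rw [hmean, div_le_iff₀' (Real.sqrt_pos.2 hn')]
  have hle := meas_ge_le_variance_div_sq hmem (c := M / √n) (by positivity)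
  rw [hset, measureReal_def]
  refine (ENNReal.toReal_mono ENNReal.ofReal_ne_top hle).trans ?_
  rw [ENNReal.toReal_ofReal (div_nonneg (variance_nonneg _ _) (by positivity)), div_pow,
    Real.sq_sqrt hn'.le, div_div_eq_mul_div, mul_comm]
  gcongr

/-- The **delta method** for a statistic of the empirical law. -/
theorem tendstoInDistribution_of_isLittleO [IsProbabilityMeasure P] (h : IsSample X p P)
    {Φ : (C → ℝ) → ℝ} {H : C → ℝ}
    (hΦ : (fun q : C → ℝ => Φ q - Φ p - ∑ c, (q c - p c) * H c) =o[𝓝[stdSimplex ℝ C] p]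
      fun q => q - p) :
    TendstoInDistribution (fun (n : ℕ) ω => √(n : ℝ) * (Φ (empiricalLaw n fun t => X t ω) - Φ p))
      atTop (id : ℝ → ℝ) (fun _ => P) (gaussianReal 0
        (∑ c, p c * (H c * H c) - (∑ c, p c * H c) * ∑ c, p c * H c).toNNReal) := by
  set Z : ℕ → Ω → ℝ := fun n ω =>
    (√n)⁻¹ * (∑ t ∈ Finset.range n, H (X t ω) - n * ∫ ω, H (X 0 ω) ∂P) with hZ
  have hZeq : ∀ n ω, Z n ω = √n * ∑ c, (empiricalLaw n (fun t => X t ω) c - p c) * H c := by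
    intro n ω
    rcases Nat.eq_zero_or_pos n with rfl | hn
    · simp [hZ]
    · have hn' : (0 : ℝ) < n := by exact_mod_cast hn
      simp_rw [hZ, sub_mul, Finset.sum_sub_distrib, sum_empiricalLaw_mul, h.integral_eq H]
      have : (√n)⁻¹ = √n / n := by
        rw [eq_div_iff hn'.ne', inv_mul_eq_div, div_eq_iff (Real.sqrt_pos.2 hn').ne',
          Real.mul_self_sqrt hn'.le]
      rw [this]
      field_simp
  have hclt : TendstoInDistribution Z atTop (id : ℝ → ℝ) (fun _ => P) (gaussianReal 0
        (∑ c, p c * (H c * H c) - (∑ c, p c * H c) * ∑ c, p c * H c).toNNReal) := by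
    refine tendstoInDistribution_inv_sqrt_mul_sum_sub (X := fun t ω => H (X t ω)) ?_ (h.memLp H 0)
      (h.indep.comp (fun _ => H) fun _ => measurable_of_countable H) (h.identDistrib H)
    rw [← covariance_self (h.measurable_comp H 0).aemeasurable, h.covariance_eq H H 0]
    exact HasLaw.id
  -- Slutsky: the central limit theorem handles the linear part `Z`, so it remains to see that the
  -- remainder tends to `0` in probability.
  refine tendstoInDistribution_of_tendstoInMeasure_sub _ _ hclt ?_ fun n =>
    (measurable_const.mul ((h.measurable_empiricalLaw_comp n Φ).sub_const _)).aemeasurable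
  rw [tendstoInMeasure_iff_measureReal_norm]
  intro ε hε
  rw [Metric.tendsto_atTop]
  intro η hη
  -- With this `M` the union bound over `C` gives `card C / M ^ 2 = η * card C / (card C + 1) < η`.
  set M : ℝ := √((Fintype.card C + 1) / η) with hM
  have hM2 : M ^ 2 = (Fintype.card C + 1) / η := Real.sq_sqrt (by positivity)
  have hMpos : 0 < M := Real.sqrt_pos.2 (by positivity)
  -- Where `√n * ‖q - p‖ ≤ M`, this constant makes the scaled remainder at most `ε / 2`.
  have hsmall := hΦ.def (c := ε / (2 * M)) (by positivity)
  rw [eventually_nhdsWithin_iff, Metric.eventually_nhds_iff] at hsmall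
  obtain ⟨δ, hδ, hsmall⟩ := hsmall
  obtain ⟨N, hN⟩ := exists_nat_gt ((M / δ) ^ 2)
  refine ⟨N + 1, fun n hn => ?_⟩
  have hn1 : 1 ≤ n := by omega
  have hn' : (0 : ℝ) < n := by exact_mod_cast hn1
  have hsq : M / δ < √n := by
    refine Real.lt_sqrt_of_sq_lt (hN.trans_le ?_)
    exact_mod_cast (by omega : N ≤ n)
  rw [dist_zero_right, Real.norm_of_nonneg measureReal_nonneg]
  calc P.real {ω | ε ≤ ‖((fun (n : ℕ) ω => √(n : ℝ) *
          (Φ (empiricalLaw n fun t => X t ω) - Φ p)) - Z) n ω - (0 : ℕ → Ω → ℝ) n ω‖}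
      ≤ P.real (⋃ c, {ω | M ≤ √n * |empiricalLaw n (fun t => X t ω) c - p c|}) := by
        refine measureReal_mono fun ω hω => ?_
        by_contra hcon
        simp only [Set.mem_iUnion, Set.mem_ofPred_eq, not_exists, not_le] at hcon
        set q := empiricalLaw n fun t => X t ω with hq
        have hnorm : √n * ‖q - p‖ ≤ M := by
          rw [← le_div_iff₀' (Real.sqrt_pos.2 hn'), pi_norm_le_iff_of_nonneg (by positivity)]
          intro c
          rw [le_div_iff₀' (Real.sqrt_pos.2 hn')]
          exact (hcon c).le
        have hdist : dist q p < δ := by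
          rw [dist_eq_norm]
          rw [div_lt_iff₀ hδ] at hsq
          exact lt_of_mul_lt_mul_left (hnorm.trans_lt hsq) (Real.sqrt_nonneg n)
        have hb := hsmall hdist (empiricalLaw_mem_stdSimplex (by omega) _)
        simp only [Set.mem_ofPred_eq, Pi.sub_apply, Pi.zero_apply, sub_zero, hZeq, ← hq,
          ← mul_sub] at hω
        rw [norm_mul, Real.norm_of_nonneg (Real.sqrt_nonneg _)] at hω
        have : √n * ‖Φ q - Φ p - ∑ c, (q c - p c) * H c‖ ≤ ε / 2 := by
          calc _ ≤ √n * (ε / (2 * M) * ‖q - p‖) := by gcongr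
            _ = ε / (2 * M) * (√n * ‖q - p‖) := by ring
            _ ≤ ε / (2 * M) * M := by gcongr
            _ = ε / 2 := by field_simp
        linarith
    _ ≤ ∑ c, P.real {ω | M ≤ √n * |empiricalLaw n (fun t => X t ω) c - p c|} :=
        measureReal_iUnion_fintype_le _
    _ ≤ ∑ _c : C, 1 / M ^ 2 :=
        Finset.sum_le_sum fun c _ => h.measureReal_sqrt_mul_abs_le c hn1 hMpos
    _ < η := by
        rw [Finset.sum_const, Finset.card_univ, nsmul_eq_mul, hM2, one_div_div, mul_div_assoc',
          div_lt_iff₀ (by positivity)]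
        nlinarith

end IsSample

end ProbabilityTheory

/-! ### Combinatorics of the tree and of single losses -/

namespace MulticastTree

section Order

variable {V : Type*} (T : MulticastTree V)

lemma below_refl (v : V) : T.Below v v := ⟨0, rfl⟩

lemma below_parent (v : V) : T.Below v (T.parent v) := ⟨1, rfl⟩

variable {T}

lemma Below.trans {u v w : V} (h₁ : T.Below u v) (h₂ : T.Below v w) : T.Below u w := by
  obtain ⟨m, rfl⟩ := h₁
  obtain ⟨n, rfl⟩ := h₂
  exact ⟨n + m, Function.iterate_add_apply _ _ _ _⟩

/-- A node strictly below another one lies below one of its children. -/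
lemma Below.exists_child {v u : V} (h : T.Below v u) (hne : v ≠ u) :
    ∃ e : T.Link, T.parent e.1 = u ∧ T.Below v e.1 := by
  classical
  have hn := Nat.find_spec h
  have hmin := fun m hm => Nat.find_min h (m := m) hm
  obtain ⟨n, hn'⟩ : ∃ n, Nat.find h = n + 1 := by
    refine Nat.exists_eq_succ_of_ne_zero fun h0 => hne ?_
    rwa [h0] at hn
  rw [hn'] at hn hmin
  rw [Function.iterate_succ_apply'] at hn
  -- Were the last node before `u` the root, its parent would be itself, so `u` would have been
  -- reached one step earlier, against minimality.
  refine ⟨⟨T.parent^[n] v, fun hroot => hmin n (Nat.lt_succ_self n) ?_⟩, hn, n, rfl⟩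
  rw [hroot, T.parent_root] at hn
  rw [hroot, hn]

/-- A node strictly below another one has its parent below that one. -/
lemma Below.parent_below {v u : V} (h : T.Below v u) (hne : v ≠ u) : T.Below (T.parent v) u := by
  obtain ⟨n, hn⟩ := h
  rcases n with _ | n
  · exact absurd hn hne
  · exact ⟨n, hn⟩

lemma Below.total {v a b : V} (ha : T.Below v a) (hb : T.Below v b) :
    T.Below a b ∨ T.Below b a := by
  obtain ⟨m, rfl⟩ := ha
  obtain ⟨n, rfl⟩ := hb
  rcases le_total m n with h | h
  · exact .inl ⟨n - m, by rw [← Function.iterate_add_apply, Nat.sub_add_cancel h]⟩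
  · exact .inr ⟨m - n, by rw [← Function.iterate_add_apply, Nat.sub_add_cancel h]⟩

/-- A node does not lie below the lower end of a link that starts there. -/
lemma not_parent_below (e : T.Link) : ¬ T.Below (T.parent e.1) e.1 := by
  rintro ⟨m, hm⟩
  have hper : T.parent^[m + 1] e.1 = e.1 := hm
  obtain ⟨n, hn⟩ := T.reaches_root e.1
  -- A cycle of length `m + 1` through `e` is back at `e` after `(m + 1) * n` steps, whereas `n`
  -- steps lead to the root, which is never left again.
  have h1 : T.parent^[(m + 1) * n] e.1 = e.1 := by
    rw [Function.iterate_mul]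
    exact Function.iterate_fixed hper n
  have h2 : T.parent^[(m + 1) * n] e.1 = T.root := by
    have : (m + 1) * n = m * n + n := by ring
    rw [this, Function.iterate_add_apply, hn]
    exact Function.iterate_fixed T.parent_root _
  exact e.2 (h1.symm.trans h2)

lemma not_below_of_parent_eq {e : T.Link} {k : V} (he : T.parent e.1 = k) : ¬ T.Below k e.1 :=
  he ▸ not_parent_below e

/-- The subtrees of two different children are disjoint. -/
lemma eq_of_below_of_below {i j : T.Link} {k v : V} (hi : T.parent i.1 = k)
    (hj : T.parent j.1 = k) (hvi : T.Below v i.1) (hvj : T.Below v j.1) : i = j := by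
  by_contra hne
  have hne' : i.1 ≠ j.1 := fun h => hne (Subtype.ext h)
  rcases hvi.total hvj with h | h
  · exact not_below_of_parent_eq hj (hi ▸ h.parent_below hne')
  · exact not_below_of_parent_eq hi (hj ▸ h.parent_below hne'.symm)

end Order

variable {V : Type*} {T : MulticastTree V} [Fintype V] [DecidableEq V]

@[simp] lemma mem_path {v : V} {e : T.Link} : e ∈ T.path v ↔ T.Below v e.1 := by simp [path]

@[simp] lemma mem_children {v : V} {e : T.Link} : e ∈ T.children v ↔ T.parent e.1 = v := by
  simp [children]

@[simp] lemma mem_receivers {v r : V} :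
    r ∈ T.receivers v ↔ T.children r = ∅ ∧ T.Below r v := by simp [receivers]

lemma reaches_iff {b : T.Link → Bool} {v : V} :
    T.Reaches b v ↔ ∀ e : T.Link, T.Below v e.1 → b e = true := by simp [Reaches]

lemma not_mem_path_of_mem_children {k : V} {j : T.Link} (hj : j ∈ T.children k) :
    j ∉ T.path k := by
  rw [mem_path]
  exact not_below_of_parent_eq (mem_children.1 hj)

variable (T) in
lemma receivers_nonempty (v : V) : (T.receivers v).Nonempty := by
  classical
  induction h : (Finset.univ.filter fun u => T.Below u v).card using Nat.strong_induction_on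
    generalizing v with
  | _ n ih =>
    rcases (T.children v).eq_empty_or_nonempty with h0 | ⟨e, he⟩
    · exact ⟨v, mem_receivers.2 ⟨h0, T.below_refl v⟩⟩
    · have hev : T.Below e.1 v := mem_children.1 he ▸ T.below_parent e.1
      have hlt : (Finset.univ.filter fun u => T.Below u e.1).card <
          (Finset.univ.filter fun u => T.Below u v).card := by
        refine Finset.card_lt_card ((Finset.ssubset_iff_of_subset fun u hu => ?_).2
          ⟨v, by simp [T.below_refl], ?_⟩)
        · simp only [Finset.mem_filter, Finset.mem_univ, true_and] at hu ⊢
          exact hu.trans hev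
        · simpa using not_below_of_parent_eq (mem_children.1 he)
      obtain ⟨r, hr⟩ := ih _ (h ▸ hlt) e.1 rfl
      exact ⟨r, mem_receivers.2 ⟨(mem_receivers.1 hr).1, (mem_receivers.1 hr).2.trans hev⟩⟩

/-- The probe is passed on from the upper end of the link `j` to a receiver at or below `j`. -/
def PassedBelow (T : MulticastTree V) (b : T.Link → Bool) (j : T.Link) : Prop :=
  ∃ r ∈ T.receivers j.1, ∀ e : T.Link, T.Below r e.1 → T.Below e.1 j.1 → b e = true

/-- On the way from a node below the child `j` of `k`, the links are those below `j` and those on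
the path to `k`. -/
lemma below_or_below {k r : V} {j e : T.Link} (hj : j ∈ T.children k) (hr : T.Below r j.1)
    (he : T.Below r e.1) : T.Below e.1 j.1 ∨ T.Below k e.1 := by
  rcases he.total hr with h | h
  · exact .inl h
  · by_cases hje : j.1 = e.1
    · exact .inl (hje ▸ T.below_refl _)
    · exact .inr (mem_children.1 hj ▸ h.parent_below hje)

lemma below_of_mem_children {k : V} {j : T.Link} (hj : j ∈ T.children k) : T.Below j.1 k :=
  mem_children.1 hj ▸ T.below_parent j.1

/-- Separates the shared part of the event, the path to `k`, from the part inside the subtree of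
`j`. Given the first, different children are independent. -/
lemma observed_child_iff {b : T.Link → Bool} {k : V} {j : T.Link} (hj : j ∈ T.children k) :
    T.Observed b j.1 ↔ T.Reaches b k ∧ T.PassedBelow b j := by
  simp only [Observed, PassedBelow, reaches_iff]
  constructor
  · rintro ⟨r, hr, h⟩
    have hrj := (mem_receivers.1 hr).2
    exact ⟨fun e he => h e ((hrj.trans (below_of_mem_children hj)).trans he),
      r, hr, fun e he _ => h e he⟩
  · rintro ⟨hk, r, hr, h⟩
    exact ⟨r, hr, fun e he => (below_or_below hj (mem_receivers.1 hr).2 he).elim (h e he) (hk e)⟩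

lemma observed_iff {b : T.Link → Bool} {k : V} (hk : (T.children k).Nonempty) :
    T.Observed b k ↔ ∃ j ∈ T.children k, T.Observed b j.1 := by
  constructor
  · rintro ⟨r, hr, h⟩
    obtain ⟨hr0, hrk⟩ := mem_receivers.1 hr
    obtain ⟨j, hj, hrj⟩ := hrk.exists_child fun h => hk.ne_empty (h ▸ hr0)
    exact ⟨j, mem_children.2 hj, r, mem_receivers.2 ⟨hr0, hrj⟩, h⟩
  · rintro ⟨j, hj, r, hr, h⟩
    exact ⟨r, mem_receivers.2 ⟨(mem_receivers.1 hr).1,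
      (mem_receivers.1 hr).2.trans (below_of_mem_children hj)⟩, h⟩

lemma observed_top (v : V) : T.Observed (fun _ => true) v := by
  obtain ⟨r, hr⟩ := T.receivers_nonempty v
  exact ⟨r, hr, fun _ _ => rfl⟩

open ProductBernoulli in
lemma reaches_loss_iff {e : T.Link} {v : V} : T.Reaches (loss e) v ↔ e ∉ T.path v := by
  simp only [Reaches, loss, decide_eq_true_eq]
  exact ⟨fun h he => h e he rfl, fun h e' he' hee => h (hee ▸ he')⟩

open ProductBernoulli in
/-- A single loss off the path to `k` only affects the child below which it happens. -/
lemma observed_loss_of_not_below {k : V} {j e : T.Link} (hj : j ∈ T.children k)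
    (hk : e ∉ T.path k) (he : ¬ T.Below e.1 j.1) : T.Observed (loss e) j.1 := by
  obtain ⟨r, hr⟩ := T.receivers_nonempty j.1
  refine ⟨r, hr, reaches_loss_iff.2 fun h => ?_⟩
  rw [mem_path] at h hk
  exact (below_or_below hj (mem_receivers.1 hr).2 h).elim he hk

open ProductBernoulli in
lemma not_observed_loss {v : V} {e : T.Link} (he : e ∈ T.path v) : ¬ T.Observed (loss e) v := by
  rintro ⟨r, hr, h⟩
  exact reaches_loss_iff.1 h (mem_path.2 ((mem_receivers.1 hr).2.trans (mem_path.1 he)))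

open ProductBernoulli in
/-- If `j` does not have exactly one child, the only single losses that prevent the observation
of a probe at `j` are those on the path to `j`. -/
lemma observed_loss_iff {k : V} {j e : T.Link} (hj : j ∈ T.children k)
    (hcard : (T.children j.1).card ≠ 1) :
    T.Observed (loss e) j.1 ↔ e ∉ T.path k ∧ e ≠ j := by
  constructor
  · intro h
    refine ⟨fun he => not_observed_loss (mem_path.2 ?_) h, fun he =>
      not_observed_loss (mem_path.2 ?_) h⟩
    · exact (below_of_mem_children hj).trans (mem_path.1 he)
    · exact he ▸ T.below_refl _
  · rintro ⟨hk, hne⟩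
    by_cases he : T.Below e.1 j.1
    · obtain ⟨a, ha, hea⟩ := he.exists_child fun h => hne (Subtype.ext h)
      have hcard' : 1 < (T.children j.1).card :=
        lt_of_le_of_ne (Finset.card_pos.2 ⟨a, mem_children.2 ha⟩) hcard.symm
      obtain ⟨b, hb, hba⟩ := Finset.exists_mem_ne hcard' a
      obtain ⟨r, hr⟩ := T.receivers_nonempty b.1
      obtain ⟨hr0, hrb⟩ := mem_receivers.1 hr
      refine ⟨r, mem_receivers.2 ⟨hr0, hrb.trans (below_of_mem_children hb)⟩,
        reaches_loss_iff.2 fun h => hba ?_⟩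
      exact eq_of_below_of_below (mem_children.1 hb) ha hrb ((mem_path.1 h).trans hea)
    · exact observed_loss_of_not_below hj hk he

/-- Off the path to `k`, a single loss hides the probe from one child of `k` at most. -/
lemma exists_forall_observed_loss {k : V} {e : T.Link} (hk : e ∉ T.path k) :
    ∀ i ∈ T.children k, ∀ j ∈ T.children k, ¬ T.Observed (ProductBernoulli.loss e) i.1 →
      ¬ T.Observed (ProductBernoulli.loss e) j.1 → i = j := by
  intro i hi j hj hi' hj'
  have h1 := not_imp_comm.1 (observed_loss_of_not_below hi hk) hi'
  have h2 := not_imp_comm.1 (observed_loss_of_not_below hj hk) hj'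
  exact eq_of_below_of_below (mem_children.1 hi) (mem_children.1 hj) h1 h2

/-! ### Indicators -/

open Classical in
/-- The indicator of the event that a probe is observed by all members of `x`. -/
noncomputable def coInd (T : MulticastTree V) (x : Finset T.Link) (b : T.Link → Bool) : ℝ :=
  if T.CoObserved b x then 1 else 0

open Classical in
/-- The indicator of the event that a probe is observed at `v`. -/
noncomputable def obsInd (T : MulticastTree V) (v : V) (b : T.Link → Bool) : ℝ :=
  if T.Observed b v then 1 else 0

open Classical in
/-- The indicator of the event that a probe reaches `v`. -/
noncomputable def reachInd (T : MulticastTree V) (v : V) (b : T.Link → Bool) : ℝ :=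
  if T.Reaches b v then 1 else 0

open Classical in
/-- The indicator of the event `PassedBelow`. -/
noncomputable def passInd (T : MulticastTree V) (j : T.Link) (b : T.Link → Bool) : ℝ :=
  if T.PassedBelow b j then 1 else 0

lemma coInd_union (x y : Finset T.Link) (b : T.Link → Bool) :
    T.coInd (x ∪ y) b = T.coInd x b * T.coInd y b := by
  have : T.CoObserved b (x ∪ y) ↔ T.CoObserved b x ∧ T.CoObserved b y := by
    simp [CoObserved, or_imp, forall_and]
  by_cases hx : T.CoObserved b x <;> by_cases hy : T.CoObserved b y <;> simp [coInd, this, hx, hy]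

lemma coInd_singleton (j : T.Link) (b : T.Link → Bool) : T.coInd {j} b = T.obsInd j.1 b := by
  have : T.CoObserved b {j} ↔ T.Observed b j.1 := by simp [CoObserved]
  by_cases h : T.Observed b j.1
  · rw [coInd, obsInd, if_pos h, if_pos (this.2 h)]
  · rw [coInd, obsInd, if_neg h, if_neg (mt this.1 h)]

lemma coInd_eq_prod (x : Finset T.Link) (b : T.Link → Bool) :
    T.coInd x b = ∏ j ∈ x, T.obsInd j.1 b := by
  classical
  simp only [coInd, obsInd, CoObserved]
  rw [Finset.prod_ite_zero]
  simp

lemma coInd_top (x : Finset T.Link) : (T.coInd x fun _ => true) = 1 := by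
  have : T.CoObserved (fun _ => true) x := fun e _ => observed_top e.1
  rw [coInd, if_pos this]

lemma obsInd_top (v : V) : (T.obsInd v fun _ => true) = 1 := by
  rw [obsInd, if_pos (observed_top v)]

lemma passInd_nonneg (j : T.Link) (b : T.Link → Bool) : 0 ≤ T.passInd j b := by
  unfold passInd; split_ifs <;> simp

lemma passInd_le_one (j : T.Link) (b : T.Link → Bool) : T.passInd j b ≤ 1 := by
  unfold passInd; split_ifs <;> simp

lemma passInd_top (j : T.Link) : (T.passInd j fun _ => true) = 1 := by
  obtain ⟨r, hr⟩ := T.receivers_nonempty j.1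
  rw [passInd, if_pos ⟨r, hr, fun _ _ _ => rfl⟩]

lemma obsInd_child {k : V} {j : T.Link} (hj : j ∈ T.children k) (b : T.Link → Bool) :
    T.obsInd j.1 b = T.reachInd k b * T.passInd j b := by
  have := observed_child_iff (b := b) hj
  by_cases h1 : T.Reaches b k <;> by_cases h2 : T.PassedBelow b j <;>
    simp [obsInd, reachInd, passInd, this, h1, h2]

/-- The factor `reachInd` is idempotent, so one copy survives from all members of `x`. For empty `x`
the left side would be `1` even if the probe misses `k`. -/
lemma coInd_eq_mul_prod {k : V} {x : Finset T.Link} (hx : x ⊆ T.children k) (hx0 : x.Nonempty)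
    (b : T.Link → Bool) : T.coInd x b = T.reachInd k b * ∏ j ∈ x, T.passInd j b := by
  rw [coInd_eq_prod, Finset.prod_congr rfl fun j hj => obsInd_child (hx hj) b,
    Finset.prod_mul_distrib, Finset.prod_const]
  congr 1
  by_cases h : T.Reaches b k
  · simp [reachInd, h]
  · simp [reachInd, h, hx0.card_pos.ne']

lemma obsInd_eq {k : V} (hk : (T.children k).Nonempty) (b : T.Link → Bool) :
    T.obsInd k b = 1 - ∏ j ∈ T.children k, (1 - T.obsInd j.1 b) := by
  classical
  by_cases h : T.Observed b k
  · obtain ⟨j, hj, hjo⟩ := (observed_iff hk).1 h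
    rw [Finset.prod_eq_zero hj (by simp [obsInd, hjo])]
    simp [obsInd, h]
  · rw [Finset.prod_eq_one]
    · simp [obsInd, h]
    · intro j hj
      have : ¬ T.Observed b j.1 := fun hjo => h ((observed_iff hk).2 ⟨j, hj, hjo⟩)
      simp [obsInd, this]

lemma obsInd_eq_mul {k : V} (hk : (T.children k).Nonempty) (b : T.Link → Bool) :
    T.obsInd k b = T.reachInd k b - T.reachInd k b * ∏ j ∈ T.children k, (1 - T.passInd j b) := by
  rw [obsInd_eq hk, Finset.prod_congr rfl fun j hj => by rw [obsInd_child hj b]]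
  by_cases h : T.Reaches b k
  · simp [reachInd, h]
  · simp [reachInd, h]

lemma dependsOn_reachInd (k : V) : DependsOn (T.reachInd k) {e : T.Link | T.Below k e.1} := by
  classical
  intro b b' h
  have : T.Reaches b k ↔ T.Reaches b' k := by
    simp only [reaches_iff]
    exact forall₂_congr fun e he => by rw [h e he]
  simp [reachInd, this]

lemma dependsOn_passInd (j : T.Link) :
    DependsOn (T.passInd j) {e : T.Link | T.Below e.1 j.1} := by
  classical
  intro b b' h
  have : T.PassedBelow b j ↔ T.PassedBelow b' j := by
    unfold PassedBelow
    refine exists_congr fun r => and_congr_right fun _ => ?_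
    exact forall₃_congr fun e _ he => by rw [h e he]
  simp [passInd, this]

/-! ### Means of the indicators -/

open ProductBernoulli

/-- The probability that a probe at the upper end of `j` is passed on to a receiver below `j`. -/
noncomputable def subtreeRate (T : MulticastTree V) (α : T.Link → ℝ) (j : T.Link) : ℝ :=
  mean α (T.passInd j)

lemma mean_reachInd (α : T.Link → ℝ) (k : V) : mean α (T.reachInd k) = T.pathRate α k := by
  classical
  have h : ∀ b : T.Link → Bool, T.reachInd k b =
      ∏ e, if e ∈ T.path k then if b e then (1 : ℝ) else 0 else 1 := by
    intro b
    rw [Finset.prod_ite_mem, Finset.univ_inter, Finset.prod_ite_zero, Finset.prod_const_one,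
      reachInd]
    congr
  rw [funext h, mean_prod α fun e (t : Bool) => if e ∈ T.path k then if t then (1 : ℝ) else 0 else 1]
  calc _ = ∏ e, if e ∈ T.path k then α e else 1 :=
        Finset.prod_congr rfl fun e _ => by split_ifs <;> simp_all
    _ = _ := by rw [Finset.prod_ite_mem, Finset.univ_inter, pathRate]

/-- The path to `k` and the subtrees of distinct children use pairwise disjoint sets of links. The
function `φ` covers both `t` (for `coInd`) and `1 - t` (for `obsInd`). -/
lemma mean_reachInd_mul_prod (α : T.Link → ℝ) {k : V} {x : Finset T.Link}
    (hx : x ⊆ T.children k) {φ : T.Link → ℝ → ℝ} :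
    mean α (fun b => T.reachInd k b * ∏ j ∈ x, φ j (T.passInd j b)) =
      T.pathRate α k * ∏ j ∈ x, mean α fun b => φ j (T.passInd j b) := by
  rw [← mean_reachInd]
  refine mean_mul_prod_of_dependsOn α x (dependsOn_reachInd k) (fun j _ b b' h => ?_) ?_ ?_
    (D := fun j => {e : T.Link | T.Below e.1 j.1})
  · rw [dependsOn_passInd j h]
  · refine fun j hj => Set.disjoint_left.2 fun e he he' => ?_
    exact not_below_of_parent_eq (mem_children.1 (hx hj)) (Below.trans he he')
  · refine fun i hi j hj hij => Set.disjoint_left.2 fun e he he' => hij ?_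
    exact eq_of_below_of_below (mem_children.1 (hx hi)) (mem_children.1 (hx hj)) he he'

lemma mean_coInd (α : T.Link → ℝ) {k : V} {x : Finset T.Link} (hx : x ⊆ T.children k)
    (hx0 : x.Nonempty) :
    mean α (T.coInd x) = T.pathRate α k * ∏ j ∈ x, T.subtreeRate α j := by
  rw [funext (coInd_eq_mul_prod hx hx0)]
  exact mean_reachInd_mul_prod α hx (φ := fun _ t => t)

lemma mean_obsInd_child (α : T.Link → ℝ) {k : V} {j : T.Link} (hj : j ∈ T.children k) :
    mean α (T.obsInd j.1) = T.pathRate α k * T.subtreeRate α j := by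
  simp_rw [← funext (coInd_singleton j)]
  rw [mean_coInd α (Finset.singleton_subset_iff.2 hj) (Finset.singleton_nonempty j),
    Finset.prod_singleton]

lemma mean_obsInd (α : T.Link → ℝ) {k : V} (hk : (T.children k).Nonempty) :
    mean α (T.obsInd k) =
      T.pathRate α k * (1 - ∏ j ∈ T.children k, (1 - T.subtreeRate α j)) := by
  rw [funext (obsInd_eq_mul hk), mean_sub, mean_reachInd,
    mean_reachInd_mul_prod α Finset.Subset.rfl (φ := fun _ t => 1 - t)]
  simp_rw [mean_sub, mean_const, subtreeRate]
  ring

lemma pathRate_pos {α : T.Link → ℝ} (hα : ∀ e, α e ∈ Set.Ioc (0 : ℝ) 1) (k : V) :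
    0 < T.pathRate α k := Finset.prod_pos fun e _ => (hα e).1

lemma subtreeRate_pos {α : T.Link → ℝ} (hα : ∀ e, α e ∈ Set.Ioc (0 : ℝ) 1) (j : T.Link) :
    0 < T.subtreeRate α j := mean_pos hα (passInd_nonneg j) (by rw [passInd_top]; exact one_pos)

lemma subtreeRate_le_one {α : T.Link → ℝ} (hα : ∀ e, α e ∈ Set.Ioc (0 : ℝ) 1) (j : T.Link) :
    T.subtreeRate α j ≤ 1 := by
  rw [← mean_const α 1]
  exact mean_mono hα (passInd_le_one j)

lemma pathRate_one (k : V) : T.pathRate 1 k = 1 := by simp [pathRate]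

lemma subtreeRate_one (j : T.Link) : T.subtreeRate 1 j = 1 := by
  rw [subtreeRate, mean_one, passInd_top]

lemma differentiable_pathRate (k : V) : Differentiable ℝ fun α => T.pathRate α k := by
  unfold pathRate
  exact fun α => DifferentiableAt.fun_finsetProd_of_real fun e _ => by fun_prop

lemma differentiable_subtreeRate (j : T.Link) : Differentiable ℝ fun α => T.subtreeRate α j :=
  differentiable_mean _

end MulticastTree

/-! ### The likelihood equation: roots, continuity and first-order expansion -/

open Asymptotics in
/-- First-order expansion of a convergent family of solutions of an equation `G (q, φ q) = 0`. -/
lemma isLittleO_of_implicit {E : Type*} [NormedAddCommGroup E] [NormedSpace ℝ E] {G : E × ℝ → ℝ}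
    {G' : E × ℝ →L[ℝ] ℝ} {p : E} {A : ℝ} (hG : HasFDerivAt G G' (p, A)) (h0 : G (p, A) = 0)
    (hD : G' (0, 1) ≠ 0) {l : Filter E} (hl : l ≤ 𝓝 p) {φ : E → ℝ} (hφ : Tendsto φ l (𝓝 A))
    (hr : ∀ᶠ q in l, G (q, φ q) = 0) :
    (fun q => φ q - A + (G' (0, 1))⁻¹ * G' (q - p, 0)) =o[l] fun q => q - p := by
  set D := G' (0, 1) with hDdef
  set e : E → ℝ := fun q => φ q - A + D⁻¹ * G' (q - p, 0) with he
  set w : E → E × ℝ := fun q => (q - p, φ q - A) with hw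
  have hto : Tendsto (fun q => (q, φ q)) l (𝓝 (p, A)) :=
    (tendsto_id'.2 hl).prodMk_nhds hφ
  have hew : e =o[l] w := by
    have h1 := hG.isLittleO.comp_tendsto hto
    refine (h1.const_mul_left (-D⁻¹)).congr' ?_ (Eventually.of_forall fun q => rfl)
    filter_upwards [hr] with q hq
    have h2 : G' (q - p, φ q - A) = G' (q - p, 0) + (φ q - A) * D := by
      have : (q - p, φ q - A) = (q - p, (0 : ℝ)) + (φ q - A) • ((0 : E), (1 : ℝ)) := by simp
      rw [this, map_add, map_smul, smul_eq_mul]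
    simp only [Function.comp_apply, hq, h0, Prod.mk_sub_mk, h2, he]
    field_simp
    ring
  -- The bound on `e` involves the unknown `φ q - A` through `w`. It is absorbed: `w` minus `(0, e)`
  -- is linear in `q - p`, and `e = o(w)` makes `w` comparable to that difference.
  have hew' : (fun q => ((0 : E), e q)) =o[l] w := by
    rw [← isLittleO_norm_left] at hew ⊢
    simpa using hew
  have hbig : (fun q => w q - ((0 : E), e q)) =O[l] fun q => q - p := by
    have h3 : (fun q => w q - ((0 : E), e q)) = fun q => (q - p, -(D⁻¹ * G' (q - p, 0))) := by
      ext q <;> simp [hw, he]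
    rw [h3]
    refine (isBigO_refl _ _).prod_left ?_
    refine IsBigO.neg_left (IsBigO.const_mul_left ?_ _)
    exact (G'.isBigO_comp (fun q => (q - p, (0 : ℝ))) l).trans
      ((isBigO_refl _ _).prod_left (isBigO_zero _ _))
  exact hew.trans_isBigO (hew'.right_isBigO_sub.trans hbig)

namespace LikelihoodEquation

variable {ι : Type*} {s : Finset ι} {a : ι → ℝ} {b : ℝ}

/-- The curve `t ↦ ∏ (1 - t + t * x j)` lies below its chord from `1` to `∏ x j`. Adding a factor
widens the gap by `t * (1 - t) * (1 - x m) * (1 - ∏ x j)`, which is positive as soon as two of the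
`x j` are below `1`. -/
lemma prod_lt_of_two {x : ι → ℝ} {t : ℝ} (ht0 : 0 < t) (ht1 : t < 1)
    (hx : ∀ j ∈ s, x j ∈ Set.Icc (0 : ℝ) 1) {i j : ι} (hi : i ∈ s) (hj : j ∈ s) (hij : i ≠ j)
    (hxi : x i < 1) (hxj : x j < 1) :
    ∏ j ∈ s, (1 - t + t * x j) < 1 - t + t * ∏ j ∈ s, x j := by
  classical
  have hle : ∀ s' ⊆ s, ∏ j ∈ s', (1 - t + t * x j) ≤ 1 - t + t * ∏ j ∈ s', x j ∧
      0 ≤ ∏ j ∈ s', x j ∧ ∏ j ∈ s', x j ≤ 1 := by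
    intro s' hs'
    induction s' using Finset.induction_on with
    | empty => simp
    | insert m s' hm ih =>
      obtain ⟨h1, h2, h3⟩ := ih fun j hj => hs' (Finset.mem_insert_of_mem hj)
      obtain ⟨hm0, hm1⟩ := hx m (hs' (Finset.mem_insert_self m s'))
      simp_rw [Finset.prod_insert hm]
      refine ⟨?_, mul_nonneg hm0 h2, mul_le_one₀ hm1 h2 h3⟩
      have h4 : 0 ≤ 1 - t + t * x m := by nlinarith
      have h5 := mul_le_mul_of_nonneg_left h1 h4
      have h6 : 0 ≤ t * (1 - t) * ((1 - x m) * (1 - ∏ j ∈ s', x j)) :=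
        mul_nonneg (mul_nonneg ht0.le (by linarith)) (mul_nonneg (by linarith) (by linarith))
      linarith
  obtain ⟨h1, h2, h3⟩ := hle (s.erase i) (Finset.erase_subset _ _)
  have hlt : ∏ j ∈ s.erase i, x j < 1 := by
    have hj' : j ∈ s.erase i := Finset.mem_erase.2 ⟨hij.symm, hj⟩
    obtain ⟨-, h5, h6⟩ := hle ((s.erase i).erase j)
      ((Finset.erase_subset _ _).trans (Finset.erase_subset _ _))
    rw [← Finset.mul_prod_erase _ _ hj']
    nlinarith [(hx j hj).1]
  rw [← Finset.mul_prod_erase _ _ hi, ← Finset.mul_prod_erase s x hi]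
  have h4 : 0 ≤ 1 - t + t * x i := by nlinarith [(hx i hi).1]
  have h5 := mul_le_mul_of_nonneg_left h1 h4
  have h6 : 0 < t * (1 - t) * ((1 - x i) * (1 - ∏ j ∈ s.erase i, x j)) :=
    mul_pos (mul_pos ht0 (by linarith)) (mul_pos (by linarith) (by linarith))
  linarith

variable (s) in
/-- The difference quotient at `0` of `u ↦ 1 - ∏ (1 - a j * u)` is continuous. -/
lemma exists_slope : ∃ κ : (ι → ℝ) × ℝ → ℝ, Continuous κ ∧
    (∀ a u, 1 - ∏ j ∈ s, (1 - a j * u) = u * κ (a, u)) ∧ ∀ a, κ (a, 0) = ∑ j ∈ s, a j := by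
  classical
  induction s using Finset.induction_on with
  | empty => exact ⟨fun _ => 0, continuous_const, by simp, by simp⟩
  | insert m s hm ih =>
    obtain ⟨κ, h1, h2, h3⟩ := ih
    refine ⟨fun z => κ z + z.1 m - z.1 m * z.2 * κ z, by fun_prop, fun a u => ?_, fun a => ?_⟩
    · rw [Finset.prod_insert hm]
      linear_combination (1 - a m * u) * h2 a u
    · rw [Finset.sum_insert hm]
      simp [h3, add_comm]

variable (s a b) in
/-- The reciprocals of the solutions of the likelihood equation. -/
def IsReciprocalRoot (u : ℝ) : Prop :=
  0 < u ∧ b * u ≤ 1 ∧ ∏ j ∈ s, (1 - a j * u) = 1 - b * u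

variable (s a b) in
/-- The solutions of the likelihood equation. -/
def IsRoot (A : ℝ) : Prop := 0 < A ∧ b ≤ A ∧ 1 - b / A = ∏ j ∈ s, (1 - a j / A)

lemma isRoot_iff {A : ℝ} : IsRoot s a b A ↔ IsReciprocalRoot s a b A⁻¹ := by
  unfold IsRoot IsReciprocalRoot
  rw [inv_pos]
  refine and_congr_right fun hA => and_congr ?_ ?_
  · rw [← div_eq_mul_inv, div_le_one hA]
  · simp_rw [← div_eq_mul_inv]
    exact eq_comm

/-- If at most one `a j` were positive, the sum would be a single term, hence at most `b`. -/
lemma exists_two (hs : s.Nonempty) (ha : ∀ j ∈ s, 0 ≤ a j ∧ a j ≤ b) (hb : b < ∑ j ∈ s, a j) :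
    ∃ i ∈ s, ∃ j ∈ s, i ≠ j ∧ 0 < a i ∧ 0 < a j := by
  by_contra! hcon
  obtain ⟨i, hi, hmax⟩ := s.exists_max_image a hs
  have h1 : ∑ j ∈ s, a j = a i := by
    refine Finset.sum_eq_single_of_mem i hi fun j hj hji => le_antisymm ?_ (ha j hj).1
    by_contra! hpos
    exact (hcon i hi j hj hji.symm (hpos.trans_le (hmax j hj))).not_gt hpos
  linarith [(ha i hi).2]

lemma IsReciprocalRoot.unique (hs : s.Nonempty) (ha : ∀ j ∈ s, 0 ≤ a j ∧ a j ≤ b) (hb : b < ∑ j ∈ s, a j)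
    {u v : ℝ} (hu : IsReciprocalRoot s a b u) (hv : IsReciprocalRoot s a b v) : u = v := by
  have key : ∀ u v : ℝ, IsReciprocalRoot s a b u → IsReciprocalRoot s a b v → ¬ u < v := by
    rintro u v ⟨hu0, -, hu⟩ ⟨hv0, hv1, hv⟩ huv
    obtain ⟨i, hi, j, hj, hij, hai, haj⟩ := exists_two hs ha hb
    -- Both roots lie on the line `1 - b * u`, which is the chord of the product from `0` to `v`. At
    -- the interior point `u` the product must be strictly below it.
    have h := prod_lt_of_two (s := s) (x := fun j => 1 - a j * v) (t := u / v) (by positivity)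
      ((div_lt_one hv0).2 huv) (fun j hj => ?_) hi hj hij (by simp; positivity)
      (by simp; positivity)
    · have h1 : ∀ j, 1 - u / v + u / v * (1 - a j * v) = 1 - a j * u := fun j => by
        field_simp; ring
      simp_rw [h1] at h
      rw [hu, hv] at h
      have h2 : 1 - u / v + u / v * (1 - b * v) = 1 - b * u := by field_simp; ring
      linarith
    · obtain ⟨h1, h2⟩ := ha j hj
      constructor
      · nlinarith
      · nlinarith [mul_nonneg h1 hv0.le]
  exact le_antisymm (not_lt.1 (key v u hv hu)) (not_lt.1 (key u v hu hv))

lemma exists_isReciprocalRoot (hs : s.Nonempty) (ha : ∀ j ∈ s, 0 ≤ a j ∧ a j ≤ b) (hb : b < ∑ j ∈ s, a j) :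
    ∃ u, IsReciprocalRoot s a b u := by
  obtain ⟨i, hi, -, -, -, hai, -⟩ := exists_two hs ha hb
  have hb0 : 0 < b := hai.trans_le (ha i hi).2
  obtain ⟨κ, h1, h2, h3⟩ := exists_slope s
  have hend : κ (a, b⁻¹) ≤ b := by
    have h4 := h2 a b⁻¹
    have h5 : 0 ≤ ∏ j ∈ s, (1 - a j * b⁻¹) := Finset.prod_nonneg fun j hj => by
      rw [sub_nonneg, ← div_eq_mul_inv, div_le_one hb0]
      exact (ha j hj).2
    have h6 : b⁻¹ * κ (a, b⁻¹) ≤ 1 := by linarith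
    rwa [inv_mul_le_iff₀ hb0, mul_one] at h6
  have hcont : ContinuousOn (fun u => κ (a, u)) (Set.Icc 0 b⁻¹) := by fun_prop
  -- Dividing the equation by `u` removes the spurious root `0` and leaves `κ (a, u) = b`. The slope
  -- is `∑ a j > b` at `0` and at most `b` at `b⁻¹`.
  obtain ⟨u, ⟨hu0, hu1⟩, hu⟩ := intermediate_value_Icc' (inv_nonneg.2 hb0.le) hcont
    ⟨hend, by simpa [h3] using hb.le⟩
  refine ⟨u, lt_of_le_of_ne hu0 ?_, ?_, ?_⟩
  · rintro rfl
    simp only [h3] at hu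
    linarith
  · rwa [← le_div_iff₀' hb0, one_div]
  · have := h2 a u
    simp only at hu
    rw [hu] at this
    linarith

lemma existsUnique_isRoot (hs : s.Nonempty) (ha : ∀ j ∈ s, 0 ≤ a j ∧ a j ≤ b) (hb : b < ∑ j ∈ s, a j) :
    ∃! A, IsRoot s a b A := by
  obtain ⟨u, hu⟩ := exists_isReciprocalRoot hs ha hb
  refine ⟨u⁻¹, isRoot_iff.2 (by rwa [inv_inv]), fun A hA => ?_⟩
  rw [← IsReciprocalRoot.unique hs ha hb (isRoot_iff.1 hA) hu, inv_inv]

variable (s a b) in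
open Classical in
/-- The solution of the likelihood equation if it is unique, and `0` otherwise. -/
noncomputable def solution : ℝ := if h : ∃! A, IsRoot s a b A then h.choose else 0

lemma isRoot_solution (h : ∃! A, IsRoot s a b A) : IsRoot s a b (solution s a b) := by
  rw [solution, dif_pos h]
  exact h.choose_spec.1

lemma solution_eq {A : ℝ} (h : ∃! A, IsRoot s a b A) (hA : IsRoot s a b A) : solution s a b = A :=
  h.unique (isRoot_solution h) hA

/-- The solution of the likelihood equation is continuous in the data. -/
lemma tendsto_solution {E : Type*} {l : Filter E} {a' : E → ι → ℝ} {b' : E → ℝ}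
    (hs : s.Nonempty) (ha : ∀ j ∈ s, 0 ≤ a j ∧ a j ≤ b) (hb : b < ∑ j ∈ s, a j)
    (ha' : ∀ᶠ q in l, ∀ j ∈ s, 0 ≤ a' q j ∧ a' q j ≤ b' q) (hta : Tendsto a' l (𝓝 a))
    (htb : Tendsto b' l (𝓝 b)) :
    (∀ᶠ q in l, IsRoot s (a' q) (b' q) (solution s (a' q) (b' q))) ∧
      Tendsto (fun q => solution s (a' q) (b' q)) l (𝓝 (solution s a b)) := by
  obtain ⟨i, hi, -, -, -, hai, -⟩ := exists_two hs ha hb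
  have hb0 : 0 < b := hai.trans_le (ha i hi).2
  have hbl : ∀ᶠ q in l, b' q < ∑ j ∈ s, a' q j :=
    htb.eventually_lt (tendsto_finsetSum s fun j _ => (tendsto_pi_nhds.1 hta j)) hb
  have hroot : ∀ᶠ q in l, IsRoot s (a' q) (b' q) (solution s (a' q) (b' q)) := by
    filter_upwards [ha', hbl] with q h1 h2 using isRoot_solution (existsUnique_isRoot hs h1 h2)
  refine ⟨hroot, ?_⟩
  have h0 := isRoot_solution (existsUnique_isRoot hs ha hb)
  -- Reciprocals of the roots eventually lie in the compact interval `[0, 2 / b]`. Any cluster point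
  -- satisfies the limiting slope equation; it is not `0`, where the slope exceeds `b`, so it is the
  -- unique reciprocal root.
  have hinv : Tendsto (fun q => (solution s (a' q) (b' q))⁻¹) l (𝓝 (solution s a b)⁻¹) := by
    obtain ⟨κ, h1, h2, h3⟩ := exists_slope s
    refine isCompact_Icc.tendsto_nhds_of_unique_mapClusterPt (s := Set.Icc 0 (2 / b)) ?_ ?_
    · filter_upwards [hroot, htb.eventually (lt_mem_nhds (half_lt_self hb0))] with q hq hbq
      obtain ⟨hA, hbA, -⟩ := hq
      refine ⟨(inv_pos.2 hA).le, ?_⟩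
      rw [inv_le_comm₀ hA (by positivity), inv_div]
      linarith
    · intro y hy hcl
      obtain ⟨U, hU, hUy⟩ := mapClusterPt_iff_ultrafilter.1 hcl
      have hsol : κ (a, y) = b := by
        have hκ : Tendsto (fun q => κ (a' q, (solution s (a' q) (b' q))⁻¹)) U (𝓝 (κ (a, y))) :=
          (h1.tendsto (a, y)).comp ((hta.mono_left hU).prodMk_nhds hUy)
        refine tendsto_nhds_unique (hκ.congr' ?_) (htb.mono_left hU)
        filter_upwards [hU hroot] with q hq
        obtain ⟨hu0, -, hu⟩ := isRoot_iff.1 hq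
        have := h2 (a' q) (solution s (a' q) (b' q))⁻¹
        rw [hu] at this
        have h5 : (solution s (a' q) (b' q))⁻¹ * (κ (a' q, (solution s (a' q) (b' q))⁻¹) - b' q) = 0 := by
          linarith
        rcases mul_eq_zero.1 h5 with h6 | h6
        · exact absurd h6 hu0.ne'
        · linarith
      have hle : b * y ≤ 1 := by
        refine le_of_tendsto ((htb.mono_left hU).mul hUy) ?_
        filter_upwards [hU hroot] with q hq using (isRoot_iff.1 hq).2.1
      have hy0 : 0 < y := by
        refine lt_of_le_of_ne hy.1 ?_
        rintro rfl
        rw [h3] at hsol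
        linarith
      refine IsReciprocalRoot.unique hs ha hb ⟨hy0, hle, ?_⟩ (isRoot_iff.1 h0)
      have := h2 a y
      rw [hsol] at this
      linarith
  simpa using hinv.inv₀ (inv_pos.2 h0.1).ne'

/-- First-order expansion of the solution of the likelihood equation. -/
lemma isLittleO_solution [DecidableEq ι] {E : Type*} [NormedAddCommGroup E] [NormedSpace ℝ E] {p : E}
    {S : Set E} {f : ι → E →L[ℝ] ℝ} {g : E →L[ℝ] ℝ} (hs : s.Nonempty) (hp : p ∈ S)
    (hS : ∀ q ∈ S, ∀ j ∈ s, 0 ≤ f j q ∧ f j q ≤ g q) (hb : g p < ∑ j ∈ s, f j p)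
    {A : ℝ} {β : ι → ℝ} (hA : IsRoot s (fun j => f j p) (g p) A)
    (hβ : ∀ j ∈ s, f j p = A * β j) {D : ℝ}
    (hD : D = 1 - ∏ j ∈ s, (1 - β j) - ∑ j ∈ s, β j * ∏ i ∈ s.erase j, (1 - β i)) (hD0 : D ≠ 0) :
    (fun q => solution s (fun j => f j q) (g q) - A -
      D⁻¹ * (g (q - p) - ∑ j ∈ s, (∏ i ∈ s.erase j, (1 - β i)) * f j (q - p))) =o[𝓝[S] p]
      fun q => q - p := by
  obtain ⟨hroot, htend⟩ := tendsto_solution (s := s) (l := 𝓝[S] p) (a' := fun q j => f j q)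
    (b' := fun q => g q) hs (hS p hp) hb
    (by filter_upwards [self_mem_nhdsWithin] with q hq using hS q hq)
    (tendsto_pi_nhds.2 fun j => ((f j).continuous.tendsto p).mono_left nhdsWithin_le_nhds)
    ((g.continuous.tendsto p).mono_left nhdsWithin_le_nhds)
  rw [solution_eq (existsUnique_isRoot hs (hS p hp) hb) hA] at htend
  obtain ⟨hA0, -, hAeq⟩ := hA
  set G : E × ℝ → ℝ := fun z => ∏ j ∈ s, (1 - f j z.1 / z.2) - (1 - g z.1 / z.2) with hG
  have hβ' : ∀ j ∈ s, 1 - f j p / A = 1 - β j := fun j hj => by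
    rw [hβ j hj, mul_div_cancel_left₀ _ hA0.ne']
  have hdiv : ∀ h : E →L[ℝ] ℝ, HasFDerivAt (fun z : E × ℝ => 1 - h z.1 / z.2)
      (-(A⁻¹ • h.comp (.fst ℝ E ℝ) - (h p / A ^ 2) • .snd ℝ E ℝ)) (p, A) := by
    intro h
    have h1 := (h.comp (.fst ℝ E ℝ)).hasFDerivAt (x := (p, A))
    have h2 := (hasDerivAt_inv hA0.ne').comp_hasFDerivAt (p, A)
      (hasFDerivAt_snd (𝕜 := ℝ) (E := E) (F := ℝ) (p := (p, A)))
    refine ((h1.mul h2).const_sub 1).congr_fderiv ?_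
    ext v
    · simp
    · simp
      field_simp
  have hGder := (HasFDerivAt.finsetProd (u := s) fun j _ => hdiv (f j)).sub (hdiv g)
  set G' := (∑ i ∈ s, (∏ j ∈ s.erase i, (1 - f j p / A)) •
      -(A⁻¹ • (f i).comp (.fst ℝ E ℝ) - (f i p / A ^ 2) • .snd ℝ E ℝ)) -
    -(A⁻¹ • g.comp (.fst ℝ E ℝ) - (g p / A ^ 2) • .snd ℝ E ℝ) with hG'
  have hprod : ∀ j, ∏ i ∈ s.erase j, (1 - f i p / A) = ∏ i ∈ s.erase j, (1 - β i) := fun j =>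
    Finset.prod_congr rfl fun i hi => hβ' i (Finset.mem_of_mem_erase hi)
  have hgp : g p / A = 1 - ∏ j ∈ s, (1 - β j) := by
    rw [Finset.prod_congr rfl hβ'] at hAeq
    linarith
  have hG1 : G' (0, 1) = -(D / A) := by
    have h1 : ∑ j ∈ s, (∏ i ∈ s.erase j, (1 - β i)) * (f j p / A ^ 2) =
        A⁻¹ * ∑ j ∈ s, β j * ∏ i ∈ s.erase j, (1 - β i) := by
      rw [Finset.mul_sum]
      refine Finset.sum_congr rfl fun j hj => ?_
      rw [hβ j hj]
      field_simp
    have h2 : g p / A ^ 2 = A⁻¹ * (g p / A) := by field_simp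
    simp only [hG', hprod]
    simp [h1, h2, hgp, hD]
    ring
  have hG2 : ∀ v, G' (v, 0) = A⁻¹ * (g v - ∑ j ∈ s, (∏ i ∈ s.erase j, (1 - β i)) * f j v) := by
    intro v
    simp only [hG', hprod]
    simp [mul_sub, Finset.mul_sum, mul_left_comm]
    ring
  have key := isLittleO_of_implicit (l := 𝓝[S] p) (G := G) hGder ?_ ?_ nhdsWithin_le_nhds htend ?_
  · refine key.congr_left fun q => ?_
    rw [hG1, hG2]
    field_simp
    ring
  · simp only [hG]
    rw [hAeq, sub_self]
  · rw [hG1]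
    exact neg_ne_zero.2 (div_ne_zero hD0 hA0.ne')
  · filter_upwards [hroot] with q hq
    simp only [hG]
    rw [hq.2.2, sub_self]

end LikelihoodEquation

/-- The linear functional with coefficients `f`, as a linear function of `f`. -/
noncomputable def coeffFunctional {C : Type*} [Fintype C] : (C → ℝ) →ₗ[ℝ] ((C → ℝ) →L[ℝ] ℝ) where
  toFun f := ∑ c, f c • ContinuousLinearMap.proj c
  map_add' f g := by simp [add_smul, Finset.sum_add_distrib]
  map_smul' a f := by simp [Finset.smul_sum, mul_smul]

lemma coeffFunctional_apply {C : Type*} [Fintype C] (f q : C → ℝ) :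
    coeffFunctional f q = ∑ c, q c * f c := by
  simp [coeffFunctional, mul_comm]

/-! ### Covariances, estimators and their influence functions -/

namespace MulticastTree

open ProductBernoulli LikelihoodEquation

variable {V : Type*} {T : MulticastTree V} [Fintype V] [DecidableEq V]

/-! ### The model and the estimators as functions of the empirical law -/

lemma IsLossModel.isSample {α : T.Link → ℝ} {Ω : Type*} [MeasurableSpace Ω] {P : Measure Ω}
    {B : ℕ → T.Link → Ω → Bool} (h : T.IsLossModel α P B) :
    IsSample (fun t ω e => B t e ω) (prob α) P where
  measurable t := measurable_pi_lambda _ fun e => h.measurable t e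
  indep := iIndepFun.curry h.measurable h.indep
  law t c := by
    have := h.indep.isProbabilityMeasure
    have hi : iIndepFun (fun e => B t e) P := h.indep.precomp (g := fun e : T.Link => (t, e))
      fun _ _ h => (Prod.mk.inj h).2
    have hset : (fun ω e => B t e ω) ⁻¹' {c} = ⋂ e ∈ (Finset.univ : Finset T.Link),
        B t e ⁻¹' {c e} := by
      ext ω
      simp [funext_iff]
    rw [hset, measureReal_def, hi.measure_inter_preimage_eq_mul Finset.univ
      (sets := fun e => {c e}) (fun e _ => measurableSet_singleton (c e)), ENNReal.toReal_prod, prob]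
    refine Finset.prod_congr rfl fun e _ => ?_
    change P.real (B t e ⁻¹' {c e}) = _
    have htrue : P.real (B t e ⁻¹' {true}) = α e := h.pass_rate t e
    cases hc : c e
    · have : B t e ⁻¹' {false} = (B t e ⁻¹' {true})ᶜ := by ext ω; simp
      rw [this, probReal_compl_eq_one_sub (h.measurable t e (measurableSet_singleton true)), htrue]
      simp
    · simp [htrue]

/-- The pass rate of `x` under the law `q`. -/
noncomputable def coRate (T : MulticastTree V) (x : Finset T.Link) :
    ((T.Link → Bool) → ℝ) →L[ℝ] ℝ := coeffFunctional (T.coInd x)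

/-- The rate of confirmed arrivals at `v` under the law `q`. -/
noncomputable def obsRate (T : MulticastTree V) (v : V) :
    ((T.Link → Bool) → ℝ) →L[ℝ] ℝ := coeffFunctional (T.obsInd v)

lemma empiricalRate_eq_sum (n : ℕ) (b : ℕ → T.Link → Bool) (x : Finset T.Link) :
    T.empiricalRate n b x = (∑ t ∈ Finset.range n, T.coInd x (b t)) / n := rfl

lemma empiricalRate_eq (n : ℕ) (b : ℕ → T.Link → Bool) (x : Finset T.Link) :
    T.empiricalRate n b x = T.coRate x (empiricalLaw n b) := by
  rw [empiricalRate_eq_sum, coRate, coeffFunctional_apply, sum_empiricalLaw_mul]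

lemma confirmedArrivals_div_eq (n : ℕ) (b : ℕ → T.Link → Bool) (v : V) :
    T.confirmedArrivals n b v / n = T.obsRate v (empiricalLaw n b) := by
  rw [obsRate, coeffFunctional_apply, sum_empiricalLaw_mul]
  rfl

/-- The composite estimator as a function of the law of the outcome of a probe. -/
noncomputable def compositeFunctional (T : MulticastTree V) (k : V) (i : ℕ)
    (q : (T.Link → Bool) → ℝ) : ℝ :=
  ((∑ x ∈ (T.children k).powersetCard i, ∏ e ∈ x, T.coRate {e} q) /
    (∑ x ∈ (T.children k).powersetCard i, T.coRate x q)) ^ (1 / ((i : ℝ) - 1))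

/-- The full likelihood estimator as a function of the law of the outcome of a probe. -/
noncomputable def fullFunctional (T : MulticastTree V) (k : V) (q : (T.Link → Bool) → ℝ) : ℝ :=
  solution (T.children k) (fun e => T.coRate {e} q) (T.obsRate k q)

lemma compositeEstimator_eq (k : V) (i n : ℕ) (b : ℕ → T.Link → Bool) :
    T.compositeEstimator k i n b = T.compositeFunctional k i (empiricalLaw n b) := by
  simp only [compositeEstimator, compositeFunctional, empiricalRate_eq]

lemma fullLikelihoodEstimator_eq (k : V) (n : ℕ) (b : ℕ → T.Link → Bool) :
    T.fullLikelihoodEstimator k n b = T.fullFunctional k (empiricalLaw n b) := by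
  have h : T.IsFullLikelihoodRoot k n b = IsRoot (T.children k)
      (fun e => T.coRate {e} (empiricalLaw n b)) (T.obsRate k (empiricalLaw n b)) := by
    ext A
    simp only [IsFullLikelihoodRoot, IsRoot, empiricalRate_eq, confirmedArrivals_div_eq]
  unfold fullLikelihoodEstimator fullFunctional solution
  -- Both estimators choose from a proof about their predicate, so the predicates are identified as
  -- wholes before the choices can agree.
  generalize T.IsFullLikelihoodRoot k n b = p at h
  subst h
  rfl

lemma passRate_eq {α : T.Link → ℝ} {Ω : Type*} [MeasurableSpace Ω] {P : Measure Ω}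
    {B : ℕ → T.Link → Ω → Bool} (h : T.IsLossModel α P B) (x : Finset T.Link) :
    T.passRate P B x = mean α (T.coInd x) := by
  have := h.isSample.integral_eq (T.coInd x) 0
  rw [mean, ← this, passRate]
  have hm : MeasurableSet {ω | T.CoObserved (fun e => B 0 e ω) x} :=
    h.isSample.measurable 0 (Set.toFinite {b | T.CoObserved b x}).measurableSet
  rw [← integral_indicator_one hm]
  rfl

lemma mul_covariance_empiricalRate {α : T.Link → ℝ} {Ω : Type*} [MeasurableSpace Ω]
    {P : Measure Ω} {B : ℕ → T.Link → Ω → Bool} (h : T.IsLossModel α P B) {n : ℕ} (hn : 1 ≤ n)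
    (x y : Finset T.Link) :
    n * covariance (fun ω => T.empiricalRate n (fun t e => B t e ω) x)
      (fun ω => T.empiricalRate n (fun t e => B t e ω) y) P = cov α (T.coInd x) (T.coInd y) :=
  h.isSample.mul_covariance_average (T.coInd x) (T.coInd y) hn

lemma cov_coInd (α : T.Link → ℝ) (x y : Finset T.Link) :
    cov α (T.coInd x) (T.coInd y) =
      mean α (T.coInd (x ∪ y)) - mean α (T.coInd x) * mean α (T.coInd y) := by
  rw [cov, ← funext (coInd_union x y)]

/-! ### Covariances to first order -/

lemma sum_loss_mul_indicator (α : T.Link → ℝ) (k : V) (z : Finset T.Link) {d : T.Link → ℝ}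
    (hd : ∀ e, d e = (if e ∈ T.path k then 1 else 0) + if e ∈ z then 1 else 0) :
    ∑ e, (1 - α e) * d e = T.pathLoss α k + T.setLoss α z := by
  simp_rw [hd, mul_add, Finset.sum_add_distrib, mul_ite, mul_one, mul_zero, Finset.sum_ite_mem,
    Finset.univ_inter]
  rfl

lemma coInd_loss {k : V} (hk : ∀ e ∈ T.children k, (T.children e.1).card ≠ 1)
    {x : Finset T.Link} (hx : x ∈ T.observerSets k) (e : T.Link) :
    T.coInd x (loss e) - (T.coInd x fun _ => true) = if e ∈ T.path k ∨ e ∈ x then -1 else 0 := by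
  classical
  obtain ⟨hx, ⟨j, hj⟩⟩ : x ⊆ T.children k ∧ x.Nonempty := by simpa [observerSets] using hx
  have : T.CoObserved (loss e) x ↔ ¬ (e ∈ T.path k ∨ e ∈ x) := by
    rw [not_or]
    constructor
    · intro h
      refine ⟨((observed_loss_iff (hx hj) (hk j (hx hj))).1 (h j hj)).1, fun he => ?_⟩
      exact ((observed_loss_iff (hx he) (hk e (hx he))).1 (h e he)).2 rfl
    · rintro ⟨h1, h2⟩ j hj
      exact (observed_loss_iff (hx hj) (hk j (hx hj))).2 ⟨h1, fun h => h2 (h ▸ hj)⟩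
  rw [coInd_top]
  by_cases h : T.CoObserved (loss e) x
  · rw [if_neg (this.1 h), coInd, if_pos h, sub_self]
  · rw [if_pos (not_not.1 (mt this.2 h)), coInd, if_neg h, zero_sub]

open Asymptotics

lemma isBigO_cov_coInd {k : V} (hk : ∀ e ∈ T.children k, (T.children e.1).card ≠ 1)
    {x y : Finset T.Link} (hx : x ∈ T.observerSets k) (hy : y ∈ T.observerSets k) :
    (fun α => cov α (T.coInd x) (T.coInd y) - (T.pathLoss α k + T.setLoss α (x ∩ y))) =O[𝓝 1]
      fun α => ‖α - 1‖ ^ 2 := by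
  have hx' : x ⊆ T.children k := (by simpa [observerSets] using hx : _ ∧ _).1
  refine (isBigO_cov_sub (f := fun _ => T.coInd x) (g := fun _ => T.coInd y)
    (fun _ => differentiableAt_const _) (fun _ => differentiableAt_const _)).congr_left fun α => ?_
  rw [sum_loss_mul_indicator α k (x ∩ y) fun e => ?_]
  rw [coInd_loss hk hx, coInd_loss hk hy]
  simp only [Finset.mem_inter]
  have hdisj : e ∈ T.path k → e ∉ x := fun h h' =>
    not_mem_path_of_mem_children (hx' h') h
  by_cases h1 : e ∈ T.path k <;> by_cases h2 : e ∈ x <;> by_cases h3 : e ∈ y <;> simp_all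

lemma lossRate_norm (α : T.Link → ℝ) : ‖T.lossRate α‖ = ‖α - 1‖ := by
  rw [norm_sub_rev]
  rfl

/-- An `O(‖α - 1‖²)` estimate with explicit constants. -/
lemma exists_bound_of_isBigO {κ : Type*} [Fintype κ] {F : κ → (T.Link → ℝ) → ℝ}
    (hF : ∀ i, F i =O[𝓝 1] fun α => ‖α - 1‖ ^ 2) :
    ∃ C : ℝ, ∃ δ > 0, ∀ α : T.Link → ℝ, ‖T.lossRate α‖ ≤ δ →
      ∀ i, |F i α| ≤ C * ‖T.lossRate α‖ ^ 2 := by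
  -- The finite family is treated as one vector-valued function, which yields a common `C` and `δ`.
  obtain ⟨C, hC⟩ := (isBigO_pi (f := fun α i => F i α)).2 hF |>.bound
  obtain ⟨δ, hδ, h⟩ := Metric.eventually_nhds_iff.1 hC
  refine ⟨C, δ / 2, half_pos hδ, fun α hα i => ?_⟩
  rw [lossRate_norm] at hα ⊢
  have := h (y := α) (by rw [dist_eq_norm]; linarith)
  rw [Real.norm_of_nonneg (by positivity : 0 ≤ ‖α - 1‖ ^ 2)] at this
  exact (norm_le_pi_norm (fun i => F i α) i).trans this

/-! ### Influence functions -/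

/-- The influence function of the full likelihood estimator. -/
noncomputable def fullInfluence (T : MulticastTree V) (k : V) (α : T.Link → ℝ)
    (c : T.Link → Bool) : ℝ :=
  (1 - ∏ j ∈ T.children k, (1 - T.subtreeRate α j) - ∑ j ∈ T.children k, T.subtreeRate α j *
    ∏ i ∈ (T.children k).erase j, (1 - T.subtreeRate α i))⁻¹ *
  (T.obsInd k c - ∑ j ∈ T.children k,
    (∏ i ∈ (T.children k).erase j, (1 - T.subtreeRate α i)) * T.coInd {j} c)

/-- The influence function of the composite estimator. -/
noncomputable def compositeInfluence (T : MulticastTree V) (k : V) (i : ℕ) (α : T.Link → ℝ)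
    (c : T.Link → Bool) : ℝ :=
  T.pathRate α k / ((i : ℝ) - 1) *
    ((∑ x ∈ (T.children k).powersetCard i, ∑ j ∈ x,
        (∏ l ∈ x.erase j, mean α (T.coInd {l})) * T.coInd {j} c) /
      (∑ x ∈ (T.children k).powersetCard i, ∏ j ∈ x, mean α (T.coInd {j})) -
    (∑ x ∈ (T.children k).powersetCard i, T.coInd x c) /
      (∑ x ∈ (T.children k).powersetCard i, mean α (T.coInd x)))

lemma prob_mem_stdSimplex {α : T.Link → ℝ} (hα : ∀ e, α e ∈ Set.Ioc (0 : ℝ) 1) :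
    prob α ∈ stdSimplex ℝ (T.Link → Bool) := ⟨prob_nonneg hα, sum_prob α⟩

lemma coRate_prob (α : T.Link → ℝ) (x : Finset T.Link) :
    T.coRate x (prob α) = mean α (T.coInd x) := by
  rw [coRate, coeffFunctional_apply, mean]

lemma obsRate_prob (α : T.Link → ℝ) (v : V) :
    T.obsRate v (prob α) = mean α (T.obsInd v) := by
  rw [obsRate, coeffFunctional_apply, mean]

/-! ### Probabilities of none, one, and at least two of several independent events -/

section Products

variable {ι : Type*} {s : Finset ι} {β : ι → ℝ}

lemma prod_one_sub_le_one (hβ : ∀ j ∈ s, 0 < β j ∧ β j ≤ 1) : ∏ j ∈ s, (1 - β j) ≤ 1 :=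
  Finset.prod_le_one (fun j hj => by linarith [(hβ j hj).2]) fun j hj => by linarith [(hβ j hj).1]

lemma prod_one_sub_lt_one (hβ : ∀ j ∈ s, 0 < β j ∧ β j ≤ 1) (hs : s.Nonempty) :
    ∏ j ∈ s, (1 - β j) < 1 := by
  classical
  obtain ⟨j, hj⟩ := hs
  rw [← Finset.mul_prod_erase _ _ hj]
  have := prod_one_sub_le_one (s := s.erase j) fun i hi => hβ i (Finset.mem_of_mem_erase hi)
  nlinarith [hβ j hj]

variable [DecidableEq ι]

/-- At most one of the events with probabilities `β` occurs: recursion for the probability. -/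
lemma prod_add_sum_insert {a : ι} (ha : a ∉ s) :
    ∏ j ∈ insert a s, (1 - β j) + ∑ j ∈ insert a s, β j * ∏ i ∈ (insert a s).erase j, (1 - β i) =
      (1 - β a) * (∏ j ∈ s, (1 - β j) + ∑ j ∈ s, β j * ∏ i ∈ s.erase j, (1 - β i)) +
        β a * ∏ j ∈ s, (1 - β j) := by
  have h : ∀ j ∈ s, β j * ∏ i ∈ (insert a s).erase j, (1 - β i) =
      (1 - β a) * (β j * ∏ i ∈ s.erase j, (1 - β i)) := fun j hj => by
    rw [Finset.erase_insert_of_ne (ne_of_mem_of_not_mem hj ha).symm,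
      Finset.prod_insert fun h => ha (Finset.mem_of_mem_erase h)]
    ring
  rw [Finset.prod_insert ha, Finset.sum_insert ha, Finset.erase_insert ha, Finset.sum_congr rfl h,
    ← Finset.mul_sum]
  ring

/-- The recursion writes the left side as a convex combination of the same quantity for `s` and of
`∏ (1 - β j)`, both at most `1`. -/
lemma prod_add_sum_le_one (hβ : ∀ j ∈ s, 0 < β j ∧ β j ≤ 1) :
    ∏ j ∈ s, (1 - β j) + ∑ j ∈ s, β j * ∏ i ∈ s.erase j, (1 - β i) ≤ 1 := by
  induction s using Finset.induction_on with
  | empty => simp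
  | insert a s ha ih =>
    have hs : ∀ j ∈ s, 0 < β j ∧ β j ≤ 1 := fun j hj => hβ j (Finset.mem_insert_of_mem hj)
    rw [prod_add_sum_insert ha]
    nlinarith [ih hs, prod_one_sub_le_one hs, hβ a (Finset.mem_insert_self a s)]

/-- This is the probability that at least two of the events occur. Up to the factor `-1 / A` it is
the derivative in the unknown `A` of the likelihood equation, so it makes the implicit expansion
possible. -/
lemma one_sub_prod_sub_sum_pos (hβ : ∀ j ∈ s, 0 < β j ∧ β j ≤ 1) (hs : 2 ≤ s.card) :
    0 < 1 - ∏ j ∈ s, (1 - β j) - ∑ j ∈ s, β j * ∏ i ∈ s.erase j, (1 - β i) := by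
  obtain ⟨a, ha⟩ : s.Nonempty := Finset.card_pos.1 (by omega)
  obtain ⟨s, ha', rfl⟩ : ∃ s', a ∉ s' ∧ insert a s' = s :=
    ⟨s.erase a, Finset.notMem_erase a s, Finset.insert_erase ha⟩
  rw [Finset.card_insert_of_notMem ha'] at hs
  have hs' : ∀ j ∈ s, 0 < β j ∧ β j ≤ 1 := fun j hj => hβ j (Finset.mem_insert_of_mem hj)
  have h1 := prod_one_sub_lt_one hs' (Finset.card_pos.1 (by omega))
  have h2 := prod_add_sum_insert (β := β) ha'
  nlinarith [prod_add_sum_le_one hs', hβ a ha]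

lemma one_sub_prod_le_sum (hβ : ∀ j ∈ s, 0 < β j ∧ β j ≤ 1) :
    1 - ∏ j ∈ s, (1 - β j) ≤ ∑ j ∈ s, β j := by
  induction s using Finset.induction_on with
  | empty => simp
  | insert a s ha ih =>
    have hs : ∀ j ∈ s, 0 < β j ∧ β j ≤ 1 := fun j hj => hβ j (Finset.mem_insert_of_mem hj)
    rw [Finset.prod_insert ha, Finset.sum_insert ha]
    nlinarith [ih hs, prod_one_sub_le_one hs, hβ a (Finset.mem_insert_self a s)]

/-- The union bound is strict, since two independent events of positive probability overlap.
Multiplied by the path rate, it is the condition for a unique root at the true law. -/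
lemma one_sub_prod_lt_sum (hβ : ∀ j ∈ s, 0 < β j ∧ β j ≤ 1) (hs : 2 ≤ s.card) :
    1 - ∏ j ∈ s, (1 - β j) < ∑ j ∈ s, β j := by
  obtain ⟨a, ha⟩ : s.Nonempty := Finset.card_pos.1 (by omega)
  obtain ⟨s, ha', rfl⟩ : ∃ s', a ∉ s' ∧ insert a s' = s :=
    ⟨s.erase a, Finset.notMem_erase a s, Finset.insert_erase ha⟩
  rw [Finset.card_insert_of_notMem ha'] at hs
  have hs' : ∀ j ∈ s, 0 < β j ∧ β j ≤ 1 := fun j hj => hβ j (Finset.mem_insert_of_mem hj)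
  have h1 := prod_one_sub_lt_one hs' (Finset.card_pos.1 (by omega))
  rw [Finset.prod_insert ha', Finset.sum_insert ha']
  nlinarith [one_sub_prod_le_sum hs', hβ a ha]

end Products

lemma subtreeRate_bounds {α : T.Link → ℝ} (hα : ∀ e, α e ∈ Set.Ioc (0 : ℝ) 1) (j : T.Link) :
    0 < T.subtreeRate α j ∧ T.subtreeRate α j ≤ 1 :=
  ⟨subtreeRate_pos hα j, subtreeRate_le_one hα j⟩

lemma coRate_prob_singleton (α : T.Link → ℝ) {k : V} {j : T.Link} (hj : j ∈ T.children k) :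
    T.coRate {j} (prob α) = T.pathRate α k * T.subtreeRate α j := by
  rw [coRate_prob, funext (coInd_singleton j), mean_obsInd_child α hj]

lemma isRoot_pathRate {α : T.Link → ℝ} (hα : ∀ e, α e ∈ Set.Ioc (0 : ℝ) 1) {k : V}
    (hk : (T.children k).Nonempty) :
    IsRoot (T.children k) (fun e => T.coRate {e} (prob α)) (T.obsRate k (prob α))
      (T.pathRate α k) := by
  have hA := pathRate_pos hα k
  have h0 : 0 ≤ ∏ j ∈ T.children k, (1 - T.subtreeRate α j) :=
    Finset.prod_nonneg fun j _ => by linarith [subtreeRate_le_one hα j]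
  refine ⟨hA, ?_, ?_⟩
  · rw [obsRate_prob, mean_obsInd α hk]
    nlinarith
  · rw [obsRate_prob, mean_obsInd α hk, mul_div_cancel_left₀ _ hA.ne', sub_sub_cancel]
    refine Finset.prod_congr rfl fun j hj => ?_
    simp only [coRate_prob_singleton α hj, mul_div_cancel_left₀ _ hA.ne']

lemma coInd_nonneg (x : Finset T.Link) (c : T.Link → Bool) : 0 ≤ T.coInd x c := by
  unfold coInd; split_ifs <;> simp

lemma coInd_singleton_le {k : V} {j : T.Link} (hj : j ∈ T.children k) (c : T.Link → Bool) :
    T.coInd {j} c ≤ T.obsInd k c := by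
  rw [coInd_singleton]
  by_cases h : T.Observed c j.1
  · have : T.Observed c k := (observed_iff ⟨j, hj⟩).2 ⟨j, hj, h⟩
    simp [obsInd, h, this]
  · have : 0 ≤ T.obsInd k c := by unfold obsInd; split_ifs <;> simp
    simpa [obsInd, h] using this

/-- First-order expansion of the full likelihood estimator. -/
lemma isLittleO_fullFunctional {α : T.Link → ℝ} (hα : ∀ e, α e ∈ Set.Ioc (0 : ℝ) 1) {k : V}
    (hk : 2 ≤ (T.children k).card) :
    T.fullFunctional k (prob α) = T.pathRate α k ∧
    (fun q => T.fullFunctional k q - T.fullFunctional k (prob α) -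
      ∑ c, (q c - prob α c) * T.fullInfluence k α c) =o[𝓝[stdSimplex ℝ (T.Link → Bool)] (prob α)]
      fun q => q - prob α := by
  have hne : (T.children k).Nonempty := Finset.card_pos.1 (by omega)
  have hA := pathRate_pos hα k
  -- These inequalities need nonnegative weights; they are why the expansion is taken within the
  -- simplex.
  have hS : ∀ q ∈ stdSimplex ℝ (T.Link → Bool), ∀ j ∈ T.children k,
      0 ≤ T.coRate {j} q ∧ T.coRate {j} q ≤ T.obsRate k q := by
    intro q hq j hj
    rw [coRate, obsRate, coeffFunctional_apply, coeffFunctional_apply]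
    exact ⟨Finset.sum_nonneg fun c _ => mul_nonneg (hq.1 c) (coInd_nonneg _ c),
      Finset.sum_le_sum fun c _ => mul_le_mul_of_nonneg_left (coInd_singleton_le hj c) (hq.1 c)⟩
  have hp := prob_mem_stdSimplex hα
  have hb : T.obsRate k (prob α) < ∑ j ∈ T.children k, T.coRate {j} (prob α) := by
    rw [Finset.sum_congr rfl fun j hj => coRate_prob_singleton α hj, ← Finset.mul_sum,
      obsRate_prob, mean_obsInd α hne]
    exact mul_lt_mul_of_pos_left
      (one_sub_prod_lt_sum (fun j _ => subtreeRate_bounds hα j) hk) hA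
  have h0 : T.fullFunctional k (prob α) = T.pathRate α k :=
    solution_eq (existsUnique_isRoot hne (hS _ hp) hb) (isRoot_pathRate hα hne)
  refine ⟨h0, ?_⟩
  have h := isLittleO_solution hne hp hS hb (isRoot_pathRate hα hne)
    (fun j hj => coRate_prob_singleton α hj) rfl
    (one_sub_prod_sub_sum_pos (fun j _ => subtreeRate_bounds hα j) hk).ne'
  rw [h0]
  refine h.congr_left fun q => ?_
  have hH : T.fullInfluence k α = (1 - ∏ j ∈ T.children k, (1 - T.subtreeRate α j) -
      ∑ j ∈ T.children k, T.subtreeRate α j *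
        ∏ i ∈ (T.children k).erase j, (1 - T.subtreeRate α i))⁻¹ •
      (T.obsInd k - ∑ j ∈ T.children k,
        (∏ i ∈ (T.children k).erase j, (1 - T.subtreeRate α i)) • T.coInd {j}) := by
    ext c
    simp [fullInfluence]
  have hsum := (coeffFunctional_apply (T.fullInfluence k α) (q - prob α)).symm
  simp only [Pi.sub_apply] at hsum
  rw [hsum, hH]
  simp [fullFunctional, coRate, obsRate]

/-- First-order expansion of the composite estimator. -/
lemma isLittleO_compositeFunctional {α : T.Link → ℝ} (hα : ∀ e, α e ∈ Set.Ioc (0 : ℝ) 1) {k : V}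
    {i : ℕ} (hi : 2 ≤ i) (hk : i ≤ (T.children k).card) :
    T.compositeFunctional k i (prob α) = T.pathRate α k ∧
    (fun q => T.compositeFunctional k i q - T.compositeFunctional k i (prob α) -
      ∑ c, (q c - prob α c) * T.compositeInfluence k i α c)
      =o[𝓝[stdSimplex ℝ (T.Link → Bool)] (prob α)] fun q => q - prob α := by
  set A := T.pathRate α k with hAdef
  have hA : 0 < A := pathRate_pos hα k
  have hi' : (0 : ℝ) < (i : ℝ) - 1 := by
    have : (2 : ℝ) ≤ i := by exact_mod_cast hi
    linarith
  set X := (T.children k).powersetCard i with hX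
  have hXne : X.Nonempty := Finset.powersetCard_nonempty.2 hk
  set m := ∑ x ∈ X, ∏ j ∈ x, T.subtreeRate α j with hm
  have hm0 : 0 < m := Finset.sum_pos (fun x _ => Finset.prod_pos fun j _ =>
    subtreeRate_pos hα j) hXne
  set S₁ : ((T.Link → Bool) → ℝ) → ℝ := fun q => ∑ x ∈ X, ∏ e ∈ x, T.coRate {e} q with hS₁
  set S₂ : ((T.Link → Bool) → ℝ) → ℝ := fun q => ∑ x ∈ X, T.coRate x q with hS₂
  have hS₁p : S₁ (prob α) = A ^ i * m := by
    rw [hm, Finset.mul_sum]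
    refine Finset.sum_congr rfl fun x hx => ?_
    obtain ⟨hx1, hx2⟩ := Finset.mem_powersetCard.1 hx
    rw [Finset.prod_congr rfl fun j hj => coRate_prob_singleton α (hx1 hj),
      Finset.prod_mul_distrib, Finset.prod_const, hx2]
  have hS₂p : S₂ (prob α) = A * m := by
    rw [hm, Finset.mul_sum]
    refine Finset.sum_congr rfl fun x hx => ?_
    obtain ⟨hx1, hx2⟩ := Finset.mem_powersetCard.1 hx
    rw [coRate_prob, mean_coInd α hx1 (Finset.card_pos.1 (by omega))]
  have hS₁0 : S₁ (prob α) ≠ 0 := by rw [hS₁p]; positivity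
  have hS₂0 : S₂ (prob α) ≠ 0 := by rw [hS₂p]; positivity
  -- Both sums carry the same factor `m`; the products contribute `A ^ i` but the joint rates only
  -- one `A`, which explains the root of order `i - 1`.
  have hr : S₁ (prob α) / S₂ (prob α) = A ^ ((i : ℝ) - 1) := by
    rw [hS₁p, hS₂p, Real.rpow_sub_one hA.ne', Real.rpow_natCast]
    field_simp
  have hrpow : (S₁ (prob α) / S₂ (prob α)) ^ (1 / ((i : ℝ) - 1)) = A := by
    rw [hr, ← Real.rpow_mul hA.le, mul_one_div_cancel hi'.ne', Real.rpow_one]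
  refine ⟨hrpow, ?_⟩
  have hd₁ : HasFDerivAt S₁ (∑ x ∈ X, ∑ j ∈ x, (∏ l ∈ x.erase j, T.coRate {l} (prob α)) •
      T.coRate {j}) (prob α) :=
    HasFDerivAt.fun_sum fun x _ => HasFDerivAt.finsetProd fun j _ => (T.coRate {j}).hasFDerivAt
  have hd₂ : HasFDerivAt S₂ (∑ x ∈ X, T.coRate x) (prob α) :=
    HasFDerivAt.fun_sum fun x _ => (T.coRate x).hasFDerivAt
  have hd := (hd₁.mul ((hasDerivAt_inv hS₂0).comp_hasFDerivAt _ hd₂)).rpow_const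
    (p := 1 / ((i : ℝ) - 1)) (.inl (mul_ne_zero hS₁0 (inv_ne_zero hS₂0)))
  refine (hd.isLittleO.mono nhdsWithin_le_nhds).congr_left fun q => ?_
  have hH : T.compositeInfluence k i α = (A / ((i : ℝ) - 1)) •
      ((S₁ (prob α))⁻¹ • ∑ x ∈ X, ∑ j ∈ x,
        (∏ l ∈ x.erase j, T.coRate {l} (prob α)) • T.coInd {j} -
      (S₂ (prob α))⁻¹ • ∑ x ∈ X, T.coInd x) := by
    ext c
    simp only [compositeInfluence, hS₁, hS₂, coRate_prob, ← hAdef, ← hX]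
    simp only [Pi.smul_apply, Pi.sub_apply, Finset.sum_apply, smul_eq_mul]
    rw [inv_mul_eq_div, inv_mul_eq_div]
  have hsum := (coeffFunctional_apply (T.compositeInfluence k i α) (q - prob α)).symm
  simp only [Pi.sub_apply] at hsum
  set L₁ := ∑ x ∈ X, ∑ j ∈ x, (∏ l ∈ x.erase j, T.coRate {l} (prob α)) • T.coRate {j} with hL₁
  set L₂ := ∑ x ∈ X, T.coRate x with hL₂
  have hL : coeffFunctional (T.compositeInfluence k i α) =
      (A / ((i : ℝ) - 1)) • ((S₁ (prob α))⁻¹ • L₁ - (S₂ (prob α))⁻¹ • L₂) := by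
    simp only [hH, map_smul, map_sub, map_sum, hL₁, hL₂, coRate]
  have hpow : (S₁ (prob α) * (S₂ (prob α))⁻¹) ^ (1 / ((i : ℝ) - 1) - 1) =
      A / (S₁ (prob α) / S₂ (prob α)) := by
    rw [← div_eq_mul_inv, Real.rpow_sub_one (div_ne_zero hS₁0 hS₂0), hrpow]
  rw [hsum, hL]
  have hval : ((1 / ((i : ℝ) - 1) * (S₁ (prob α) * (S₂ (prob α))⁻¹) ^ (1 / ((i : ℝ) - 1) - 1)) •
      (S₁ (prob α) • -(S₂ (prob α) ^ 2)⁻¹ • L₂ + (S₂ (prob α))⁻¹ • L₁)) =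
      (A / ((i : ℝ) - 1)) • ((S₁ (prob α))⁻¹ • L₁ - (S₂ (prob α))⁻¹ • L₂) := by
    rw [hpow]
    ext v
    simp only [smul_apply, add_apply, sub_apply, smul_eq_mul]
    field_simp
    ring
  rw [← hval]
  rfl

lemma differentiableAt_fullInfluence {k : V} (hk : 2 ≤ (T.children k).card)
    (c : T.Link → Bool) : DifferentiableAt ℝ (fun α => T.fullInfluence k α c) 1 := by
  have hβ : ∀ j, DifferentiableAt ℝ (fun α => T.subtreeRate α j) 1 := fun j =>
    differentiable_subtreeRate j 1
  have hprod : ∀ s : Finset T.Link,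
      DifferentiableAt ℝ (fun α => ∏ j ∈ s, (1 - T.subtreeRate α j)) 1 := fun s =>
    .fun_finsetProd_of_real fun j _ => (hβ j).const_sub 1
  refine DifferentiableAt.mul (DifferentiableAt.inv ?_ ?_) ?_
  · exact ((hprod _).const_sub 1).sub (.fun_sum fun j _ => (hβ j).mul (hprod _))
  · exact (one_sub_prod_sub_sum_pos (fun j _ => by simp [subtreeRate_one]) hk).ne'
  · exact (DifferentiableAt.fun_sum fun j _ => (hprod _).mul_const _).const_sub _

lemma differentiableAt_compositeInfluence {k : V} {i : ℕ}
    (hk : i ≤ (T.children k).card) (c : T.Link → Bool) :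
    DifferentiableAt ℝ (fun α => T.compositeInfluence k i α c) 1 := by
  have hm : ∀ x : Finset T.Link, DifferentiableAt ℝ (fun α => mean α (T.coInd x)) 1 := fun x =>
    differentiable_mean _ 1
  have hX : 0 < ((T.children k).powersetCard i).card :=
    Finset.card_pos.2 (Finset.powersetCard_nonempty.2 hk)
  simp only [compositeInfluence, div_eq_mul_inv]
  refine ((differentiable_pathRate k 1).mul_const _).mul (.sub (.mul ?_ (.inv ?_ ?_))
    (.mul (differentiableAt_const _) (.inv ?_ ?_)))
  · exact .fun_sum fun x _ => .fun_sum fun j _ =>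
      (DifferentiableAt.fun_finsetProd_of_real fun l _ => hm _).mul_const _
  · exact .fun_sum fun x _ => .fun_finsetProd_of_real fun l _ => hm _
  · simpa [mean_one, coInd_top] using hX.ne'
  · exact .fun_sum fun x _ => hm _
  · simpa [mean_one, coInd_top] using hX.ne'

/-- Without losses, the full likelihood estimator only reacts to losses on the path to `k`. -/
lemma fullInfluence_loss {k : V} (hk : 2 ≤ (T.children k).card) (e : T.Link) :
    T.fullInfluence k 1 (loss e) - (T.fullInfluence k 1 fun _ => true) =
      if e ∈ T.path k then -1 else 0 := by
  have hne : (T.children k).Nonempty := Finset.card_pos.1 (by omega)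
  -- At `α = 1` every `subtreeRate` is `1`. A product over all children but one still has a zero
  -- factor, as there are two children; so the denominator is `1` and only `obsInd k` is left.
  have hone : ∀ c, T.fullInfluence k 1 c = T.obsInd k c := by
    intro c
    have h1 : ∏ j ∈ T.children k, (1 - T.subtreeRate 1 j) = 0 := by
      obtain ⟨j, hj⟩ := hne
      exact Finset.prod_eq_zero hj (by rw [subtreeRate_one, sub_self])
    have h2 : ∀ j, ∏ i ∈ (T.children k).erase j, (1 - T.subtreeRate 1 i) = 0 := by
      intro j
      obtain ⟨i, hi, hij⟩ := Finset.exists_mem_ne (s := T.children k) (by omega) j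
      exact Finset.prod_eq_zero (Finset.mem_erase.2 ⟨hij, hi⟩) (by rw [subtreeRate_one, sub_self])
    simp [fullInfluence, h1, h2]
  rw [hone, hone, obsInd_top]
  split_ifs with he
  · rw [obsInd, if_neg (not_observed_loss he), zero_sub]
  · obtain ⟨i, hi, j, hj, hij⟩ := Finset.one_lt_card.1 (by omega : 1 < (T.children k).card)
    have : T.Observed (loss e) k := by
      rw [observed_iff hne]
      by_contra! h
      exact hij (exists_forall_observed_loss he i hi j hj (h i hi) (h j hj))
    rw [obsInd, if_pos this, sub_self]

/-- At `α = 1` all rates are `1` and both denominators count the `i`-subsets, so the influence is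
the average of `(∑ obsInd - coInd) / (i - 1)` over them. -/
lemma compositeInfluence_one {k : V} {i : ℕ} (hi : 2 ≤ i) (hk : i ≤ (T.children k).card)
    {c : T.Link → Bool} {a : ℝ} (h : ∀ x ∈ (T.children k).powersetCard i,
      ∑ j ∈ x, T.obsInd j.1 c - T.coInd x c = (i - 1) * a) :
    T.compositeInfluence k i 1 c = a := by
  have hX : (((T.children k).powersetCard i).card : ℝ) ≠ 0 := by
    exact_mod_cast (Finset.card_pos.2 (Finset.powersetCard_nonempty.2 hk)).ne'
  have hi' : (i : ℝ) - 1 ≠ 0 := by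
    have : (2 : ℝ) ≤ i := by exact_mod_cast hi
    linarith
  have hsum := Finset.sum_congr rfl h
  rw [Finset.sum_sub_distrib, Finset.sum_const, nsmul_eq_mul] at hsum
  simp only [compositeInfluence, mean_one, coInd_top, pathRate_one, Finset.prod_const_one, one_mul,
    Finset.sum_const, nsmul_eq_mul, mul_one, coInd_singleton]
  rw [← sub_div, hsum]
  field_simp

/-- If one member of `x` misses the probe, the sum and the joint indicator both drop by one, and the
difference does not notice. This cancellation makes the composite estimator insensitive to losses
off the path. -/
lemma sum_obsInd_sub_coInd {k : V} {c : T.Link → Bool}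
    (hc : ∀ i ∈ T.children k, ∀ j ∈ T.children k, ¬ T.Observed c i.1 → ¬ T.Observed c j.1 → i = j)
    {x : Finset T.Link} (hx : x ⊆ T.children k) :
    ∑ j ∈ x, T.obsInd j.1 c - T.coInd x c = x.card - 1 := by
  rw [coInd_eq_prod]
  by_cases h : ∀ j ∈ x, T.Observed c j.1
  · have h1 : ∀ j ∈ x, T.obsInd j.1 c = 1 := fun j hj => by rw [obsInd, if_pos (h j hj)]
    rw [Finset.sum_congr rfl h1, Finset.prod_congr rfl h1]
    simp
  · push Not at h
    obtain ⟨j, hj, hjo⟩ := h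
    have h0 : T.obsInd j.1 c = 0 := by rw [obsInd, if_neg hjo]
    have h1 : ∀ i ∈ x.erase j, T.obsInd i.1 c = 1 := fun i hi => by
      obtain ⟨hij, hi⟩ := Finset.mem_erase.1 hi
      rw [obsInd, if_pos]
      by_contra hio
      exact hij (hc i (hx hi) j (hx hj) hio hjo)
    rw [← Finset.add_sum_erase _ _ hj, Finset.prod_eq_zero hj h0, Finset.sum_congr rfl h1, h0]
    have := Finset.card_pos.2 ⟨j, hj⟩
    simp [Finset.card_erase_of_mem hj, Nat.cast_sub (show 1 ≤ x.card from this)]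

/-- Without losses, the composite estimator only reacts to losses on the path to `k`. -/
lemma compositeInfluence_loss {k : V} {i : ℕ} (hi : 2 ≤ i) (hk : i ≤ (T.children k).card)
    (e : T.Link) :
    T.compositeInfluence k i 1 (loss e) - (T.compositeInfluence k i 1 fun _ => true) =
      if e ∈ T.path k then -1 else 0 := by
  have hgood : ∀ c : T.Link → Bool, (∀ i ∈ T.children k, ∀ j ∈ T.children k,
      ¬ T.Observed c i.1 → ¬ T.Observed c j.1 → i = j) → T.compositeInfluence k i 1 c = 1 := by
    intro c hc
    refine compositeInfluence_one hi hk fun x hx => ?_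
    obtain ⟨hx1, hx2⟩ := Finset.mem_powersetCard.1 hx
    rw [sum_obsInd_sub_coInd hc hx1, hx2, mul_one]
  rw [hgood (fun _ => true) fun i _ _ _ h => absurd (observed_top i.1) h]
  split_ifs with he
  -- A loss on the path to `k` hides the probe from all children at once, so every term is `0`.
  · rw [compositeInfluence_one hi hk (a := 0), zero_sub]
    intro x hx
    obtain ⟨hx1, hx2⟩ := Finset.mem_powersetCard.1 hx
    have h0 : ∀ j ∈ x, T.obsInd j.1 (loss e) = 0 := fun j hj => by
      rw [obsInd, if_neg (not_observed_loss ?_)]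
      exact mem_path.2 ((below_of_mem_children (hx1 hj)).trans (mem_path.1 he))
    obtain ⟨j, hj⟩ : x.Nonempty := Finset.card_pos.1 (by omega)
    rw [Finset.sum_eq_zero h0, coInd_eq_prod, Finset.prod_eq_zero hj (h0 j hj)]
    simp
  · rw [hgood _ (exists_forall_observed_loss he), sub_self]

/-- In the single-loss formula a link of the path contributes `(-1) * (-1)` times its loss rate, and
all other links contribute nothing. -/
lemma isBigO_cov_sub_pathLoss {k : V} {H : (T.Link → ℝ) → (T.Link → Bool) → ℝ}
    (hH : ∀ c, DifferentiableAt ℝ (fun α => H α c) 1)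
    (hloss : ∀ e, H 1 (loss e) - (H 1 fun _ => true) = if e ∈ T.path k then -1 else 0) :
    (fun α => cov α (H α) (H α) - T.pathLoss α k) =O[𝓝 1] fun α => ‖α - 1‖ ^ 2 := by
  refine (isBigO_cov_sub hH hH).congr_left fun α => ?_
  congr 1
  simp [hloss, pathLoss, lossRate]

end MulticastTree

/-! ### The main theorem -/

open MulticastTree ProductBernoulli in
theorem mainTheorem8 {V : Type*} [Fintype V] [DecidableEq V] (T : MulticastTree V) (k : V) :
    -- the exact covariances of the empirical pass rates
    (∀ α : T.Link → ℝ, (∀ e, α e ∈ Set.Ioc (0 : ℝ) 1) →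
      ∀ (Ω : Type*) [MeasurableSpace Ω] (P : Measure Ω) [IsProbabilityMeasure P]
        (B : ℕ → T.Link → Ω → Bool), T.IsLossModel α P B →
      ∀ n : ℕ, 1 ≤ n → ∀ x ∈ T.observerSets k, ∀ y ∈ T.observerSets k,
        (y ⊆ x →
          n * covariance (fun ω => T.empiricalRate n (fun t e => B t e ω) x)
              (fun ω => T.empiricalRate n (fun t e => B t e ω) y) P
            = T.passRate P B x * (1 - T.passRate P B y)) ∧
        n * covariance (fun ω => T.empiricalRate n (fun t e => B t e ω) x)
            (fun ω => T.empiricalRate n (fun t e => B t e ω) y) P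
          = T.passRate P B (x ∪ y) - T.passRate P B x * T.passRate P B y) ∧
    -- the covariances to first order in the loss rates
    ((∀ e ∈ T.children k, (T.children e.1).card ≠ 1) →
      ∃ C : ℝ, ∃ δ > 0, ∀ α : T.Link → ℝ, (∀ e, α e ∈ Set.Ioc (0 : ℝ) 1) →
        ‖T.lossRate α‖ ≤ δ →
      ∀ (Ω : Type*) [MeasurableSpace Ω] (P : Measure Ω) [IsProbabilityMeasure P]
        (B : ℕ → T.Link → Ω → Bool), T.IsLossModel α P B →
      ∀ n : ℕ, 1 ≤ n → ∀ x ∈ T.observerSets k, ∀ y ∈ T.observerSets k,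
        |n * covariance (fun ω => T.empiricalRate n (fun t e => B t e ω) x)
            (fun ω => T.empiricalRate n (fun t e => B t e ω) y) P
          - (T.pathLoss α k + T.setLoss α (x ∩ y))| ≤ C * ‖T.lossRate α‖ ^ 2) ∧
    -- asymptotic normality, with `w` for the full likelihood estimator and `v` for the composite one
    (2 ≤ (T.children k).card →
      ∃ w : (T.Link → ℝ) → ℝ≥0,
        (∀ α : T.Link → ℝ, (∀ e, α e ∈ Set.Ioc (0 : ℝ) 1) →
          ∀ (Ω : Type*) [MeasurableSpace Ω] (P : Measure Ω) [IsProbabilityMeasure P]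
            (B : ℕ → T.Link → Ω → Bool), T.IsLossModel α P B →
          TendstoInDistribution
            (fun (n : ℕ) ω => √(n : ℝ) *
              (T.fullLikelihoodEstimator k n (fun t e => B t e ω) - T.pathRate α k))
            atTop (id : ℝ → ℝ) (fun _ => P) (gaussianReal 0 (w α))) ∧
        ∀ i : ℕ, 2 ≤ i → i ≤ (T.children k).card →
          ∃ v : (T.Link → ℝ) → ℝ≥0,
            (∀ α : T.Link → ℝ, (∀ e, α e ∈ Set.Ioc (0 : ℝ) 1) →
              ∀ (Ω : Type*) [MeasurableSpace Ω] (P : Measure Ω) [IsProbabilityMeasure P]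
                (B : ℕ → T.Link → Ω → Bool), T.IsLossModel α P B →
              TendstoInDistribution
                (fun (n : ℕ) ω => √(n : ℝ) *
                  (T.compositeEstimator k i n (fun t e => B t e ω) - T.pathRate α k))
                atTop (id : ℝ → ℝ) (fun _ => P) (gaussianReal 0 (v α))) ∧
            ∃ C : ℝ, ∃ δ > 0, ∀ α : T.Link → ℝ, (∀ e, α e ∈ Set.Ioc (0 : ℝ) 1) →
              ‖T.lossRate α‖ ≤ δ →
              |(v α : ℝ) - T.pathLoss α k| ≤ C * ‖T.lossRate α‖ ^ 2 ∧
              |(w α : ℝ) - T.pathLoss α k| ≤ C * ‖T.lossRate α‖ ^ 2 ∧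
              |(v α : ℝ) - (w α : ℝ)| ≤ C * ‖T.lossRate α‖ ^ 2) := by
  refine ⟨?_, ?_, ?_⟩
  · intro α hα Ω _ P _ B hB n hn x hx y hy
    rw [mul_covariance_empiricalRate hB hn, cov_coInd, passRate_eq hB, passRate_eq hB,
      passRate_eq hB]
    refine ⟨fun hyx => ?_, rfl⟩
    rw [Finset.union_eq_left.2 hyx]
    ring
  · intro hk
    obtain ⟨C, δ, hδ, h⟩ := exists_bound_of_isBigO
      (κ := {x // x ∈ T.observerSets k} × {x // x ∈ T.observerSets k})
      (fun i => isBigO_cov_coInd hk i.1.2 i.2.2)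
    refine ⟨C, δ, hδ, fun α hα hαδ Ω _ P _ B hB n hn x hx y hy => ?_⟩
    rw [mul_covariance_empiricalRate hB hn]
    exact h α hαδ (⟨x, hx⟩, ⟨y, hy⟩)
  · intro hk
    refine ⟨fun α => (cov α (T.fullInfluence k α) (T.fullInfluence k α)).toNNReal,
      fun α hα Ω _ P _ B hB => ?_, fun i hi hik =>
      ⟨fun α => (cov α (T.compositeInfluence k i α) (T.compositeInfluence k i α)).toNNReal,
        fun α hα Ω _ P _ B hB => ?_, ?_⟩⟩
    · obtain ⟨h1, h2⟩ := isLittleO_fullFunctional hα hk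
      have := hB.isSample.tendstoInDistribution_of_isLittleO h2
      simp only [fullLikelihoodEstimator_eq]
      rw [h1] at this
      exact this
    · obtain ⟨h1, h2⟩ := isLittleO_compositeFunctional hα hi hik
      have := hB.isSample.tendstoInDistribution_of_isLittleO h2
      simp only [compositeEstimator_eq]
      rw [h1] at this
      exact this
    · have hw := isBigO_cov_sub_pathLoss (differentiableAt_fullInfluence hk) (fullInfluence_loss hk)
      have hv := isBigO_cov_sub_pathLoss (differentiableAt_compositeInfluence hik)
        (compositeInfluence_loss hi hik)
      -- The estimates for `v`, `w` and `v - w` are bundled to share one `C` and one `δ`; in the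
      -- third the path loss cancels.
      obtain ⟨C, δ, hδ, h⟩ := exists_bound_of_isBigO (κ := Fin 3) (F := ![_, _, _])
        (Fin.forall_fin_succ.2 ⟨hv, Fin.forall_fin_two.2 ⟨hw, hv.sub hw⟩⟩)
      refine ⟨C, δ, hδ, fun α hα hαδ => ?_⟩
      rw [Real.coe_toNNReal _ (cov_self_nonneg hα _), Real.coe_toNNReal _ (cov_self_nonneg hα _)]
      refine ⟨h α hαδ 0, h α hαδ 1, ?_⟩
      simpa using h α hαδ 2
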